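/- Let $d\ge 1$, let $\lambda_1,\dots,\lambda_d\in\mathbf C$ (not necessarily distinct), and let $$\gamma(s)=\prod_{k=1}^d\Gamma\Big(\frac{s+\lambda_k}{2}\Big).$$ Let $\phi$ be the inverse Mellin transform of $\gamma$, that is, for $t>0$, $$\phi(t)=\frac1{2\pi i}\int_{\sigma-i\infty}^{\sigma+i\infty}\gamma(s)\,t^{-s}\,ds,$$ where $\sigma$ is any real number with $\sigma+\operatorname{Re}\lambda_k>0$ for all $k$. The integral converges absolutely, and $\gamma(s)=\int_0^\infty\phi(t)t^s\frac{dt}{t}$ (absolutely convergent) whenever $\operatorname{Re}(s+\lambda_k)>0$ for all $k$. Call two indices $i,k\in\{1,\dots,d\}$ equivalent if $\lambda_i-\lambda_k\in2\mathbf Z$. Let $\Lambda_1,\dots,\Lambda_N$ be the equivalence classes of indices and $l_j=|\Lambda_j|$, so that $\sum_j l_j=d$. Put $m_j=2-\lambda_{k_j}$, where $k_j\in\Lambda_j$ is an index for which $\operatorname{Re}\lambda_{k_j}$ is smallest. Then $\gamma$ is analytic at $m_j$. Let $c_j^{(0)}(s)$ be the Taylor series of $\gamma(s+m_j)$ at $s=0$,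 truncated before the term in $s^{l_j}$, and for $n\ge1$ define Laurent series at $s=0$ recursively by $$c_j^{(n)}(s)=c_j^{(n-1)}(s)\Big/\prod_{k=1}^d\Big(\frac{s+\lambda_k+m_j}{2}-n\Big).$$ Let $c_{j,k}^{(n)}$ be the coefficient of $s^{-k}$ in $c_j^{(n)}(s)$. Then, for $1\le j\le N$: 1. For every $n\ge 0$, $\gamma(s+m_j-2n)=\sum_{k=1}^{l_j}c_{j,k}^{(n)}s^{-k}+O(1)$ as $s\to0$. 2. For $1\le k\le l_j$, with $B_j=\frac12\sum_{i=1}^d\operatorname{Re}(\lambda_i+m_j)$, $$c_{j,k}^{(n)}=O\big(n^{B_j}(\ln n)^{l_j-k}(n!)^{-d}\big)\quad\text{as }n\to\infty.$$ Moreover, for every real $t>0$, $\phi(t)$ is the (unconditionally convergent) sum of residues $$\phi(t)=\sum_{z\in\mathbf C}\operatorname{res}_{s=z}\gamma(s)t^{-s},$$ and $$\phi(t)=\sum_{j=1}^N t^{-m_j}\sum_{n=1}^\infty\Big(\sum_{k=0}^{l_j-1}\frac{(-\ln t)^k}{k!}\,c_{j,k+1}^{(n)}\Big)t^{2n},$$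 where each of the $N$ inner series over $n$ converges absolutely. -/

import Mathlib

open Filter Topology Asymptotics
open scoped Real

noncomputable section

namespace GammaFactor

/-- The residue of `f` at an isolated singularity `z`:
`(1 / 2πi) ∮ f(s) ds` over the circle `|s - z| = r`, for `r → 0⁺`
(the integral does not depend on `r` once `r` is small). -/
def residue (f : ℂ → ℂ) (z : ℂ) : ℂ :=
  limUnder (𝓝[>] (0 : ℝ)) fun r : ℝ => (2 * (π : ℂ) * Complex.I)⁻¹ * ∮ s in C(z, r), f s

/-- The Γ-factor `γ(s) = ∏ₖ Γ((s + λₖ) / 2)`. -/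
def gammaFactor {d : ℕ} (lam : Fin d → ℂ) (s : ℂ) : ℂ :=
  ∏ k, Complex.Gamma ((s + lam k) / 2)

/-- Indices `j`, `k` are equivalent when `λⱼ - λₖ ∈ 2ℤ`. -/
def modTwo {d : ℕ} (lam : Fin d → ℂ) : Setoid (Fin d) where
  r j k := ∃ z : ℤ, lam j - lam k = 2 * (z : ℂ)
  iseqv :=
    { refl := fun _ => ⟨0, by simp⟩
      symm := by
        rintro j k ⟨z, hz⟩
        exact ⟨-z, by push_cast; linear_combination -hz⟩
      trans := by
        rintro i j k ⟨z, hz⟩ ⟨w, hw⟩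
        exact ⟨z + w, by push_cast; linear_combination hz + hw⟩ }

/-- The set of equivalence classes `Λ_1, …, Λ_N`. The classes consist of indices, so that
the `λₖ` are counted with multiplicity. -/
abbrev Cls {d : ℕ} (lam : Fin d → ℂ) : Type := Quotient (modTwo lam)

instance {d : ℕ} (lam : Fin d → ℂ) : Fintype (Cls lam) := Fintype.ofFinite _

/-- The class of the index `k`. -/
def cls {d : ℕ} (lam : Fin d → ℂ) (k : Fin d) : Cls lam := Quotient.mk (modTwo lam) k

/-- The size `l_j` of a class. -/
def size {d : ℕ} (lam : Fin d → ℂ) (j : Cls lam) : ℕ := Nat.card {k : Fin d // cls lam k = j}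

theorem exists_base {d : ℕ} (lam : Fin d → ℂ) (j : Cls lam) :
    ∃ k : Fin d, cls lam k = j ∧ ∀ i : Fin d, cls lam i = j → (lam k).re ≤ (lam i).re := by
  classical
  obtain ⟨k₀, hk₀⟩ := Quotient.exists_rep j
  obtain ⟨k, hk, hmin⟩ := Finset.exists_min_image
    (Finset.univ.filter fun k : Fin d => cls lam k = j) (fun k => (lam k).re)
    ⟨k₀, Finset.mem_filter.2 ⟨Finset.mem_univ _, hk₀⟩⟩
  exact ⟨k, by simpa using hk, fun i hi => hmin i (by simpa using hi)⟩

/-- An index in the class `j` whose `λ` has the smallest real part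
(the value of `λ` there does not depend on the choice). -/
def base {d : ℕ} (lam : Fin d → ℂ) (j : Cls lam) : Fin d := (exists_base lam j).choose

theorem base_spec {d : ℕ} (lam : Fin d → ℂ) (j : Cls lam) :
    cls lam (base lam j) = j ∧
      ∀ i : Fin d, cls lam i = j → (lam (base lam j)).re ≤ (lam i).re :=
  (exists_base lam j).choose_spec

/-- The number `m_j = 2 - λ`, with `λ` the element of smallest real part in the class `j`. -/
def m {d : ℕ} (lam : Fin d → ℂ) (j : Cls lam) : ℂ := -lam (base lam j) + 2

/-- The Laurent series `c_j^{(n)}(s)`. For `n = 0` it is the Taylor series of `γ(s + m_j)` at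
`s = 0`, cut off before the term `s^{l_j}`, and then
`c_j^{(n)}(s) = c_j^{(n-1)}(s) / ∏ₖ ((s + λₖ + m_j) / 2 - n)`,
a quotient in the field of Laurent series, where `HahnSeries.single 1 1` is the variable `s`. -/
def c {d : ℕ} (lam : Fin d → ℂ) (j : Cls lam) : ℕ → LaurentSeries ℂ
  | 0 => HahnSeries.ofPowerSeries ℤ ℂ (PowerSeries.mk fun i : ℕ =>
      if i < size lam j then
        iteratedDeriv i (fun s : ℂ => gammaFactor lam (s + m lam j)) 0 / (i.factorial : ℂ)
      else 0)
  | n + 1 => c lam j n /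
      ∏ k, ((HahnSeries.single (1 : ℤ) (1 : ℂ) + HahnSeries.C (lam k + m lam j)) / 2
        - ((n + 1 : ℕ) : LaurentSeries ℂ))

/-- The coefficient `c_{j,k}^{(n)}` of `s^{-k}` in `c_j^{(n)}(s)`. -/
def coeffC {d : ℕ} (lam : Fin d → ℂ) (j : Cls lam) (n k : ℕ) : ℂ :=
  (c lam j n).coeff (-(k : ℤ))

/-- The polynomial `∑_{k < l_j} (-ln t)^k / k! · c_{j,k+1}^{(n)}` in `ln t`. -/
def logPoly {d : ℕ} (lam : Fin d → ℂ) (j : Cls lam) (n : ℕ) (t : ℝ) : ℂ :=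
  ∑ k ∈ Finset.range (size lam j),
    (-(Real.log t : ℂ)) ^ k / (k.factorial : ℂ) * coeffC lam j n (k + 1)

/-- The exponent `B_j = ½ ∑ₖ Re(λₖ + m_j)`. -/
def growthExponent {d : ℕ} (lam : Fin d → ℂ) (j : Cls lam) : ℝ :=
  (∑ k, (lam k + m lam j).re) / 2

end GammaFactor

end

/-! The expansion of `φ` comes from moving the line of integration to the left. The relation Γ(s+1)
= sΓ(s) trades a factor |Im s|^n for a shift by n into the half-plane where |Γ| is at most Γ(Re s),
so `γ` decays at least quadratically on every vertical strip (`exists_gammaFactor_decay`). Hence `φ`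
does not depend on σ, and Fourier inversion recovers `γ` from `φ`.

By the residue theorem for strips (`integral_vertical_sub`), passing from σ to σ - 2n costs exactly
the residues in between. The remaining integral tends to 0, because γ(s - 2) = γ(s) / ∏ ((s + λₖ)/2
- 1), iterated n times, divides the integrand by a product of size about (n!)^d, uniformly on the
line (`norm_gammaFactor_sub_le`, `tendsto_shrink_mul_pow`). Since the sum of residues converges
absolutely by the coefficient bounds, this one sequence of partial sums determines its value
(`hasSum_residues`).

The same functional equation gives the principal parts. Each step of the recursion divides by linear
factors s/2 + b. A factor with b ≠ 0 preserves the pole order and the number of correct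
coefficients, and a factor with b = 0 only shifts them. An index contributes at most one vanishing
factor over all n, and only if it lies in the class, so the pole order stays at most l_j and the l_j
Taylor coefficients suffice (`sum_card_shift_le_size`, `isExpansion_c`).

For the growth, the coefficients are majorized by those of K s^{-l} / (1 - L s). Division by s/2 + b
multiplies K by 1/|b| and adds 1/|b| to L. Thus K becomes a product controlled by Euler's limit for
Γ, and L a harmonic sum, which produces the powers of ln n (`CoeffBound.div_lin`, `isBigO_coeffC`).
-/

namespace GammaFactor

open MeasureTheory

/-! ### Principal parts, removable singularities and residues. -/

/-- The function `f` has the principal part `∑_{k = 1}^l a_k (s - z)^{-k}` at `z`, up to a bounded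
term. -/
def HasPrincipalPart (f : ℂ → ℂ) (z : ℂ) (l : ℕ) (a : ℕ → ℂ) : Prop :=
  (fun s => f (s + z) - ∑ k ∈ Finset.Icc 1 l, a k / s ^ k) =O[𝓝[≠] 0] fun _ => (1 : ℝ)

theorem tendsto_sub_nhdsNE (z : ℂ) : Tendsto (fun s : ℂ => s - z) (𝓝[≠] z) (𝓝[≠] 0) := by
  refine tendsto_nhdsWithin_iff.2 ⟨?_, ?_⟩
  · have : Tendsto (fun s : ℂ => s - z) (𝓝 z) (𝓝 (z - z)) := (continuous_id.sub continuous_const).tendsto z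
    rw [sub_self] at this
    exact this.mono_left nhdsWithin_le_nhds
  · filter_upwards [self_mem_nhdsWithin] with s hs
    simpa [sub_eq_zero] using hs

theorem HasPrincipalPart.isBigO_sub {f : ℂ → ℂ} {z : ℂ} {l : ℕ} {a : ℕ → ℂ}
    (h : HasPrincipalPart f z l a) :
    (fun s => f s - ∑ k ∈ Finset.Icc 1 l, a k / (s - z) ^ k) =O[𝓝[≠] z] fun _ => (1 : ℝ) := by
  have := h.comp_tendsto (tendsto_sub_nhdsNE z)
  simpa [Function.comp_def] using this

/-- Finitely many bounded isolated singularities can be removed. -/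
theorem exists_differentiable_extension {f : ℂ → ℂ} {U S : Set ℂ} (hS : S.Finite)
    (hf : ∀ s ∈ U, s ∉ S → DifferentiableAt ℂ f s)
    (hd : ∀ z ∈ S, ∀ᶠ s in 𝓝[≠] z, DifferentiableAt ℂ f s)
    (hb : ∀ z ∈ S, f =O[𝓝[≠] z] fun _ => (1 : ℝ)) :
    ∃ g : ℂ → ℂ, (∀ s ∈ U ∪ S, DifferentiableAt ℂ g s) ∧ ∀ s ∉ S, g s = f s := by
  classical
  let g : ℂ → ℂ := fun s => if s ∈ S then limUnder (𝓝[≠] s) f else f s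
  have hgf : ∀ s ∉ S, g =ᶠ[𝓝 s] f := fun s hs => by
    filter_upwards [hS.isClosed.isOpen_compl.mem_nhds hs] with w hw
    exact if_neg hw
  have hgS : ∀ z ∈ S, DifferentiableAt ℂ g z := fun z hz => by
    have hpun : ∀ᶠ s in 𝓝[≠] z, s ∉ S := by
      have h1 : (S \ {z})ᶜ ∈ 𝓝 z :=
        (hS.subset Set.sdiff_subset).isClosed.isOpen_compl.mem_nhds (by simp)
      filter_upwards [nhdsWithin_le_nhds h1, self_mem_nhdsWithin] with s hs hs' hsS
      exact hs ⟨hsS, hs'⟩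
    have hlim : Tendsto f (𝓝[≠] z) (𝓝 (limUnder (𝓝[≠] z) f)) := by
      refine Complex.tendsto_limUnder_of_differentiable_on_punctured_nhds_of_bounded_under
        (hd z hz) ?_
      have h1 : (fun s => f s - f z) =O[𝓝[≠] z] fun _ => (1 : ℝ) :=
        (hb z hz).sub (isBigO_const_const _ one_ne_zero _)
      exact (isBigO_one_iff ℝ).1 h1
    refine (Complex.analyticAt_of_differentiable_on_punctured_nhds_of_continuousAt
      ?_ ?_).differentiableAt
    · filter_upwards [hpun, hd z hz] with s hs hs'
      exact hs'.congr_of_eventuallyEq (hgf s hs)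
    · rw [continuousAt_iff_punctured_nhds]
      have : g z = limUnder (𝓝[≠] z) f := if_pos hz
      rw [this]
      refine hlim.congr' ?_
      filter_upwards [hpun] with s hs
      exact (if_neg hs).symm
  refine ⟨g, fun s hs => ?_, fun s hs => if_neg hs⟩
  by_cases hsS : s ∈ S
  · exact hgS s hsS
  · exact (hf s (hs.resolve_right hsS) hsS).congr_of_eventuallyEq (hgf s hsS)

/-- The residue at an isolated singularity is the coefficient of `(s - z)⁻¹`. -/
theorem HasPrincipalPart.residue_eq {f : ℂ → ℂ} {z : ℂ} {l : ℕ} {a : ℕ → ℂ} (hl : 1 ≤ l)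
    (h : HasPrincipalPart f z l a) (hd : ∀ᶠ s in 𝓝[≠] z, DifferentiableAt ℂ f s) :
    residue f z = a 1 := by
  have hP : ∀ s, s ≠ z → DifferentiableAt ℂ
      (fun s => ∑ k ∈ Finset.Icc 1 l, a k / (s - z) ^ k) s := fun s hs => by
    have hsz : s - z ≠ 0 := sub_ne_zero.2 hs
    fun_prop (disch := simp [hsz])
  obtain ⟨ε, hε, hεd⟩ := Metric.mem_nhdsWithin_iff.1 hd
  obtain ⟨g, hg, hgf⟩ := exists_differentiable_extension (U := Metric.ball z ε) (S := {z})
    (f := fun s => f s - ∑ k ∈ Finset.Icc 1 l, a k / (s - z) ^ k) (Set.finite_singleton z)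
    (fun s hs hsz => (hεd ⟨hs, hsz⟩ : DifferentiableAt ℂ f s).sub (hP s hsz))
    (fun w hw => by
      obtain rfl := Set.mem_singleton_iff.1 hw
      filter_upwards [hd, self_mem_nhdsWithin] with s hs hsz
      exact hs.sub (hP s hsz))
    (fun w hw => by
      obtain rfl := Set.mem_singleton_iff.1 hw
      exact h.isBigO_sub)
  -- The circle integral is constant for 0 < r < ε, so the limit is that of an eventually constant
  -- function.
  refine Tendsto.limUnder_eq (tendsto_const_nhds.congr' ?_)
  filter_upwards [Ioo_mem_nhdsGT hε] with r hr
  have hr0 : 0 < r := hr.1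
  have hne : ∀ s ∈ Metric.sphere z r, s ≠ z := fun s hs hsz => by
    rw [hsz, Metric.mem_sphere, dist_self] at hs
    exact hr0.ne hs
  have hgz : ∮ s in C(z, r), g s = 0 :=
    Complex.circleIntegral_eq_zero_of_differentiable_on_off_countable hr0.le
      Set.countable_empty
      (fun s hs => (hg s (Or.inl (Metric.closedBall_subset_ball hr.2 hs))).continuousAt.continuousWithinAt)
      (fun s hs => hg s (Or.inl (Metric.ball_subset_ball hr.2.le hs.1)))
  have hgc : CircleIntegrable g z r := ContinuousOn.circleIntegrable hr0.le fun s hs =>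
      (hg s (Or.inl (Metric.closedBall_subset_ball hr.2
        (Metric.sphere_subset_closedBall hs)))).continuousAt.continuousWithinAt
  have hterm : ∀ k ∈ Finset.Icc 1 l, CircleIntegrable (fun s => a k / (s - z) ^ k) z r :=
    fun k _ => ContinuousOn.circleIntegrable hr0.le fun s hs => by
      have hsz : s - z ≠ 0 := sub_ne_zero.2 (hne s hs)
      have : ContinuousAt (fun s => a k / (s - z) ^ k) s := by fun_prop (disch := simp [hsz])
      exact this.continuousWithinAt
  have hint : ∀ k ∈ Finset.Icc 1 l, ∮ s in C(z, r), a k / (s - z) ^ k =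
      if k = 1 then a 1 * (2 * π * Complex.I) else 0 := fun k hk => by
    have hk1 := (Finset.mem_Icc.1 hk).1
    have e : (fun s : ℂ => a k / (s - z) ^ k) = fun s => a k * (s - z) ^ (-(k : ℤ)) := by
      funext s
      rw [zpow_neg, zpow_natCast, div_eq_mul_inv]
    rw [e, circleIntegral.integral_const_mul]
    split_ifs with h1
    · subst h1
      have := circleIntegral.integral_sub_center_inv z hr0.ne'
      simp only [Nat.cast_one, zpow_neg, zpow_one]
      rw [this]
    · rw [circleIntegral.integral_sub_zpow_of_ne (by omega), mul_zero]
  have hsum : CircleIntegrable (fun s => ∑ k ∈ Finset.Icc 1 l, a k / (s - z) ^ k) z r :=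
    CircleIntegrable.fun_sum _ hterm
  have key : ∮ s in C(z, r), f s = a 1 * (2 * π * Complex.I) := by
    have e : ∮ s in C(z, r), f s =
        ∮ s in C(z, r), (g s + ∑ k ∈ Finset.Icc 1 l, a k / (s - z) ^ k) :=
      circleIntegral.integral_congr hr0.le fun s hs => by
        simp only [hgf s (hne s hs), sub_add_cancel]
    rw [e, circleIntegral.integral_add hgc hsum, hgz, zero_add,
      circleIntegral.integral_fun_sum hterm, Finset.sum_congr rfl hint, Finset.sum_ite_eq',
      if_pos (Finset.mem_Icc.2 ⟨le_rfl, hl⟩)]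
  rw [key]
  have := Complex.two_pi_I_ne_zero
  field_simp

/-! ### Integrals along vertical lines and the residue theorem for a strip. -/

theorem integrable_of_decay {f : ℝ → ℂ} (hf : Continuous f) {C Y : ℝ}
    (h : ∀ y, Y ≤ |y| → ‖f y‖ ≤ C / y ^ 2) : Integrable f := by
  set Z := max Y 1
  obtain ⟨M, hM⟩ := (isCompact_Icc (a := -Z) (b := Z)).exists_bound_of_continuousOn hf.continuousOn
  have hZ : 1 ≤ Z := le_max_right _ _
  have hM0 : 0 ≤ M := (norm_nonneg _).trans (hM 0 ⟨by linarith, by linarith⟩)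
  -- The first constant serves |y| ≤ Z, by compactness; the second serves |y| ≥ Z ≥ 1, where 1 + y²
  -- ≤ 2y².
  refine Integrable.mono' (integrable_inv_one_add_sq.const_mul (M * (1 + Z ^ 2) + 2 * |C|))
    hf.aestronglyMeasurable (ae_of_all _ fun y => ?_)
  have hy : 0 < 1 + y ^ 2 := by positivity
  rw [← div_eq_mul_inv, le_div_iff₀ hy]
  rcases le_total |y| Z with hyZ | hyZ
  · have h1 := hM y (abs_le.1 hyZ)
    have h2 : y ^ 2 ≤ Z ^ 2 := by
      rw [← sq_abs]; exact pow_le_pow_left₀ (abs_nonneg _) hyZ 2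
    calc ‖f y‖ * (1 + y ^ 2) ≤ M * (1 + Z ^ 2) := by gcongr
      _ ≤ _ := by linarith [abs_nonneg C]
  · have h1 := h y ((le_max_left _ _).trans hyZ)
    have h2 : 1 ≤ y ^ 2 := by
      rw [← sq_abs]; nlinarith [hZ.trans hyZ]
    have h3 : ‖f y‖ ≤ |C| / y ^ 2 := h1.trans (by gcongr; exact le_abs_self C)
    rw [le_div_iff₀ (by linarith)] at h3
    have h4 : 0 ≤ M * (1 + Z ^ 2) := by positivity
    nlinarith [norm_nonneg (f y)]

theorem vertical_ne_zero {c : ℝ} (hc : c ≠ 0) (y : ℝ) : (c : ℂ) + y * Complex.I ≠ 0 := fun h => by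
  apply hc
  simpa using congrArg Complex.re h

theorem norm_vertical_ge (c y : ℝ) : |y| ≤ ‖(c : ℂ) + y * Complex.I‖ := by
  simpa using Complex.abs_im_le_norm ((c : ℂ) + y * Complex.I)

theorem integrable_inv_vertical_pow {c : ℝ} (hc : c ≠ 0) {k : ℕ} (hk : 2 ≤ k) :
    Integrable fun y : ℝ => (((c : ℂ) + y * Complex.I) ^ k)⁻¹ := by
  refine integrable_of_decay (C := 1) (Y := 1) ?_ fun y hy => ?_
  · refine Continuous.inv₀ (by fun_prop) fun y => pow_ne_zero _ (vertical_ne_zero hc y)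
  · rw [norm_inv, norm_pow, ← sq_abs, ← one_div]
    have h1 := norm_vertical_ge c y
    have h2 : |y| ^ 2 ≤ ‖(c : ℂ) + y * Complex.I‖ ^ k :=
      (pow_le_pow_left₀ (abs_nonneg _) h1 2).trans (pow_le_pow_right₀ (hy.trans h1) hk)
    exact one_div_le_one_div_of_le (by positivity) h2

theorem tendsto_inv_vertical_pow (c : ℝ) {k : ℕ} (hk : 1 ≤ k) {l : Filter ℝ}
    (hl : Tendsto (fun y : ℝ => |y|) l atTop) :
    Tendsto (fun y : ℝ => (((c : ℂ) + y * Complex.I) ^ k)⁻¹) l (𝓝 0) := by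
  have h1 : Tendsto (fun y : ℝ => ‖(c : ℂ) + y * Complex.I‖) l atTop :=
    tendsto_atTop_mono (norm_vertical_ge c) hl
  have h2 := tendsto_inv_atTop_zero.comp ((tendsto_pow_atTop (by omega : k ≠ 0)).comp h1)
  rw [tendsto_zero_iff_norm_tendsto_zero]
  simpa [Function.comp_def] using h2

/-- For exponent at least 2 the integrand has an antiderivative that is a multiple of a negative
power, which vanishes at both ends of the line. -/
theorem integral_inv_vertical_pow {c : ℝ} (hc : c ≠ 0) {k : ℕ} (hk : 2 ≤ k) :
    ∫ y : ℝ, (((c : ℂ) + y * Complex.I) ^ k)⁻¹ = 0 := by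
  obtain ⟨k, rfl⟩ := Nat.exists_eq_add_of_le hk
  have hk0 : ((k : ℂ) + 1) ≠ 0 := by exact_mod_cast Nat.succ_ne_zero k
  have hd : ∀ y : ℝ, HasDerivAt
      (fun y : ℝ => (Complex.I / (k + 1)) * (((c : ℂ) + y * Complex.I) ^ (k + 1))⁻¹)
      ((((c : ℂ) + y * Complex.I) ^ (2 + k))⁻¹) y := fun y => by
    have h0 := vertical_ne_zero hc y
    have h1 : HasDerivAt (fun y : ℝ => (c : ℂ) + y * Complex.I) Complex.I y := by
      simpa using ((Complex.ofRealCLM.hasDerivAt (x := y)).mul_const Complex.I).const_add (c : ℂ)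
    have h2 := ((h1.pow (k + 1)).inv (pow_ne_zero _ h0)).const_mul (Complex.I / (k + 1))
    refine h2.congr_deriv ?_
    simp only [Pi.pow_apply]
    generalize (c : ℂ) + y * Complex.I = w at h0 ⊢
    have e : Complex.I / (k + 1) * (-(((k + 1 : ℕ) : ℂ) * w ^ (k + 1 - 1) * Complex.I) /
        (w ^ (k + 1)) ^ 2) = -(Complex.I ^ 2) * (w ^ k / (w ^ (k + 1)) ^ 2) := by
      push_cast
      field_simp
    rw [e, Complex.I_sq, neg_neg, one_mul]
    field_simp
    ring
  have h0 : ∀ {l : Filter ℝ}, Tendsto (fun y : ℝ => |y|) l atTop → Tendsto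
      (fun y : ℝ => (Complex.I / (k + 1)) * (((c : ℂ) + y * Complex.I) ^ (k + 1))⁻¹) l (𝓝 0) :=
    fun hl => by
      simpa using (tendsto_inv_vertical_pow c (k := k + 1) (by omega) hl).const_mul
        (Complex.I / (k + 1))
  rw [integral_of_hasDerivAt_of_tendsto hd (integrable_inv_vertical_pow hc (by omega))
    (h0 tendsto_abs_atBot_atTop) (h0 tendsto_abs_atTop_atTop), sub_zero]

theorem integral_div_sq_add_sq {c : ℝ} (hc : 0 < c) :
    Integrable (fun y : ℝ => c / (c ^ 2 + y ^ 2)) ∧ ∫ y : ℝ, c / (c ^ 2 + y ^ 2) = π := by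
  have e : (fun y : ℝ => c / (c ^ 2 + y ^ 2)) = fun y => c⁻¹ * (1 + (y / c) ^ 2)⁻¹ := by
    funext y
    field_simp
  rw [e]
  refine ⟨(integrable_inv_one_add_sq.comp_div hc.ne').const_mul _, ?_⟩
  rw [integral_const_mul, Measure.integral_comp_div (fun x : ℝ => (1 + x ^ 2)⁻¹) c,
    integral_univ_inv_one_add_sq, abs_of_pos hc, smul_eq_mul, inv_mul_cancel_left₀ hc.ne']

/-- Neither inverse is integrable alone, but their difference decays like y⁻². Adding the values at
y and -y leaves only Poisson kernels, and the opposite signs of `c₁` and `c₂` make their two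
contributions add up. -/
theorem integral_inv_vertical_sub {c₁ c₂ : ℝ} (h₁ : 0 < c₁) (h₂ : c₂ < 0) :
    Integrable (fun y : ℝ => ((c₁ : ℂ) + y * Complex.I)⁻¹ - ((c₂ : ℂ) + y * Complex.I)⁻¹) ∧
    ∫ y : ℝ, (((c₁ : ℂ) + y * Complex.I)⁻¹ - ((c₂ : ℂ) + y * Complex.I)⁻¹) = 2 * π := by
  set D : ℝ → ℂ := fun y => ((c₁ : ℂ) + y * Complex.I)⁻¹ - ((c₂ : ℂ) + y * Complex.I)⁻¹ with hD
  have hn₁ := vertical_ne_zero h₁.ne'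
  have hn₂ := vertical_ne_zero h₂.ne
  have hint : Integrable D := by
    refine integrable_of_decay (C := c₁ - c₂) (Y := 1) ?_ fun y hy => ?_
    · exact (Continuous.inv₀ (by fun_prop) hn₁).sub (Continuous.inv₀ (by fun_prop) hn₂)
    · have hy0 : (0 : ℝ) < |y| := by linarith
      rw [hD]
      simp only
      rw [inv_sub_inv (hn₁ y) (hn₂ y), norm_div, norm_mul, ← sq_abs, pow_two |y|]
      have : ((c₂ : ℂ) + y * Complex.I - (c₁ + y * Complex.I)) = ((c₂ - c₁ : ℝ) : ℂ) := by
        push_cast; ring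
      rw [this, Complex.norm_real, Real.norm_eq_abs, abs_of_neg (by linarith), neg_sub]
      have := norm_vertical_ge c₁ y
      have := norm_vertical_ge c₂ y
      have : 0 ≤ c₁ - c₂ := by linarith
      gcongr
  refine ⟨hint, ?_⟩
  have hR : (fun y : ℝ => D y + D (-y)) = fun y : ℝ =>
      ((2 * (c₁ / (c₁ ^ 2 + y ^ 2)) + 2 * (-c₂ / ((-c₂) ^ 2 + y ^ 2)) : ℝ) : ℂ) := by
    funext y
    have e : ∀ c : ℝ, c ≠ 0 → ((c : ℂ) + y * Complex.I)⁻¹ + ((c : ℂ) + (-y : ℝ) * Complex.I)⁻¹ =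
        ((2 * (c / (c ^ 2 + y ^ 2)) : ℝ) : ℂ) := fun c hc => by
      have h3 := vertical_ne_zero hc y
      have h4 := vertical_ne_zero hc (-y)
      have h5 : (c : ℂ) ^ 2 + (y : ℂ) ^ 2 ≠ 0 := by
        have : (0 : ℝ) < c ^ 2 + y ^ 2 := by positivity
        exact_mod_cast this.ne'
      rw [inv_add_inv h3 h4]
      have h6 : ((c : ℂ) + y * Complex.I) * ((c : ℂ) + (-y : ℝ) * Complex.I) =
          (c : ℂ) ^ 2 + (y : ℂ) ^ 2 := by
        push_cast
        linear_combination (-(y : ℂ) ^ 2) * Complex.I_sq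
      rw [h6]
      push_cast
      field_simp
      ring
    have e₁ := e c₁ h₁.ne'
    have e₂ := e c₂ h₂.ne
    simp only [hD]
    have : ((2 * (c₁ / (c₁ ^ 2 + y ^ 2)) + 2 * (-c₂ / ((-c₂) ^ 2 + y ^ 2)) : ℝ) : ℂ) =
      ((2 * (c₁ / (c₁ ^ 2 + y ^ 2)) : ℝ) : ℂ) - ((2 * (c₂ / (c₂ ^ 2 + y ^ 2)) : ℝ) : ℂ) := by
      push_cast; ring
    rw [this, ← e₁, ← e₂]
    ring
  obtain ⟨i₁, v₁⟩ := integral_div_sq_add_sq h₁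
  obtain ⟨i₂, v₂⟩ := integral_div_sq_add_sq (neg_pos.2 h₂)
  have h2 : ∫ y : ℝ, (D y + D (-y)) = 2 * ∫ y, D y := by
    rw [integral_add hint hint.comp_neg, integral_neg_eq_self]
    ring
  rw [hR, integral_complex_ofReal, integral_add (i₁.const_mul 2) (i₂.const_mul 2),
    integral_const_mul, integral_const_mul, v₁, v₂] at h2
  have h3 : (2 : ℂ) * ∫ y, D y = 2 * (2 * π) := by
    rw [← h2]; push_cast; ring
  exact mul_left_cancel₀ two_ne_zero h3

/-- The contribution of a single polar term to the difference of two vertical integrals. -/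
theorem integral_inv_pow_vertical_sub {σ₁ σ₂ : ℝ} {z : ℂ} (h₁ : z.re < σ₁) (h₂ : σ₂ < z.re)
    {k : ℕ} (hk : 1 ≤ k) :
    Integrable (fun y : ℝ => ((((σ₁ : ℂ) + y * Complex.I) - z) ^ k)⁻¹
      - ((((σ₂ : ℂ) + y * Complex.I) - z) ^ k)⁻¹) ∧
    ∫ y : ℝ, (((((σ₁ : ℂ) + y * Complex.I) - z) ^ k)⁻¹
      - ((((σ₂ : ℂ) + y * Complex.I) - z) ^ k)⁻¹) = if k = 1 then 2 * (π : ℂ) else 0 := by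
  set D : ℝ → ℂ := fun y => ((((σ₁ - z.re : ℝ) : ℂ) + y * Complex.I) ^ k)⁻¹
      - ((((σ₂ - z.re : ℝ) : ℂ) + y * Complex.I) ^ k)⁻¹ with hD
  have e : (fun y : ℝ => ((((σ₁ : ℂ) + y * Complex.I) - z) ^ k)⁻¹
      - ((((σ₂ : ℂ) + y * Complex.I) - z) ^ k)⁻¹) = fun y => D (y - z.im) := by
    funext y
    have : ∀ σ : ℝ, ((σ : ℂ) + y * Complex.I) - z =
        ((σ - z.re : ℝ) : ℂ) + ((y - z.im : ℝ) : ℂ) * Complex.I := fun σ => by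
      conv_lhs => rw [← Complex.re_add_im z]
      push_cast
      ring
    simp only [hD, this]
  have key : Integrable D ∧ ∫ y, D y = if k = 1 then 2 * (π : ℂ) else 0 := by
    split_ifs with hk1
    · subst hk1
      simpa [hD] using integral_inv_vertical_sub (sub_pos.2 h₁) (sub_neg.2 h₂)
    · have hk2 : 2 ≤ k := by omega
      have n₁ : σ₁ - z.re ≠ 0 := (sub_pos.2 h₁).ne'
      have n₂ : σ₂ - z.re ≠ 0 := (sub_neg.2 h₂).ne
      have i₁ := integrable_inv_vertical_pow n₁ hk2
      have i₂ := integrable_inv_vertical_pow n₂ hk2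
      refine ⟨i₁.sub i₂, ?_⟩
      rw [hD, integral_sub i₁ i₂, integral_inv_vertical_pow n₁ hk2,
        integral_inv_vertical_pow n₂ hk2, sub_zero]
  rw [e]
  exact ⟨key.1.comp_sub_right _, by rw [integral_sub_right_eq_self D]; exact key.2⟩

/-- For a holomorphic function on a vertical strip that tends to `0` at its two ends, the truncated
integrals over the two edges differ by `o(1)`. -/
theorem tendsto_integral_edges {G : ℂ → ℂ} {σ₁ σ₂ : ℝ} (h : σ₂ ≤ σ₁)
    (hG : ∀ s : ℂ, s.re ∈ Set.Icc σ₂ σ₁ → DifferentiableAt ℂ G s)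
    (hdec : ∀ ε > 0, ∃ Y, ∀ s : ℂ, s.re ∈ Set.Icc σ₂ σ₁ → Y ≤ |s.im| → ‖G s‖ ≤ ε) :
    Tendsto (fun T : ℝ => ∫ y in (-T)..T, (G (σ₁ + y * Complex.I) - G (σ₂ + y * Complex.I)))
      atTop (𝓝 0) := by
  have hcont : ∀ σ ∈ Set.Icc σ₂ σ₁, Continuous fun y : ℝ => G (σ + y * Complex.I) :=
    fun σ hσ => continuous_iff_continuousAt.2 fun y => by
      have h1 : ContinuousAt G ((σ : ℂ) + y * Complex.I) := (hG _ (by simpa using hσ)).continuousAt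
      exact ContinuousAt.comp (f := fun y : ℝ => (σ : ℂ) + y * Complex.I) h1 (by fun_prop)
  rw [Metric.tendsto_atTop]
  intro ε hε
  -- Each of the two horizontal edges then contributes less than ε / 2; the added 1 keeps the
  -- denominator positive when σ₁ = σ₂.
  obtain ⟨Y, hY⟩ := hdec (ε / (2 * (σ₁ - σ₂ + 1))) (by
    have : 0 < σ₁ - σ₂ + 1 := by linarith
    positivity)
  refine ⟨max Y 0, fun T hT => ?_⟩
  have hT0 : 0 ≤ T := (le_max_right _ _).trans hT
  have hTY : Y ≤ T := (le_max_left _ _).trans hT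
  have hrect := Complex.integral_boundary_rect_eq_zero_of_differentiableOn G
    ⟨σ₂, -T⟩ ⟨σ₁, T⟩ (fun s hs => by
      refine (hG s ?_).differentiableWithinAt
      have := hs.1
      simpa [Set.uIcc_of_le h] using this)
  simp only at hrect
  have hedge : ∀ τ : ℝ, |τ| = T →
      ‖∫ x in σ₂..σ₁, G (x + τ * Complex.I)‖ ≤ ε / (2 * (σ₁ - σ₂ + 1)) * (σ₁ - σ₂) :=
    fun τ hτ => by
      have := intervalIntegral.norm_integral_le_of_norm_le_const (a := σ₂) (b := σ₁)
        (f := fun x : ℝ => G (x + τ * Complex.I)) (C := ε / (2 * (σ₁ - σ₂ + 1))) fun x hx => by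
          rw [Set.uIoc_of_le h] at hx
          exact hY _ (by simpa using ⟨hx.1.le, hx.2⟩) (by simpa [hτ] using hTY)
      rwa [abs_of_nonneg (sub_nonneg.2 h)] at this
  have e₁ := hedge (-T) (by rw [abs_neg, abs_of_nonneg hT0])
  have e₂ := hedge T (abs_of_nonneg hT0)
  have i : ∀ σ ∈ Set.Icc σ₂ σ₁,
      IntervalIntegrable (fun y : ℝ => G (σ + y * Complex.I)) volume (-T) T :=
    fun σ hσ => (hcont σ hσ).intervalIntegrable _ _
  rw [dist_zero_right, intervalIntegral.integral_sub (i σ₁ ⟨h, le_rfl⟩) (i σ₂ ⟨le_rfl, h⟩)]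
  have hnorm : ‖Complex.I • ((∫ y in (-T)..T, G (σ₁ + y * Complex.I)) -
      ∫ y in (-T)..T, G (σ₂ + y * Complex.I))‖ =
      ‖(∫ x in σ₂..σ₁, G (x + T * Complex.I)) - ∫ x in σ₂..σ₁, G (x + (-T : ℝ) * Complex.I)‖ := by
    congr 1
    rw [smul_sub]
    linear_combination hrect
  rw [norm_smul, Complex.norm_I, one_mul] at hnorm
  rw [hnorm]
  refine (norm_sub_le _ _).trans_lt ?_
  have h3 : 0 < σ₁ - σ₂ + 1 := by linarith
  calc _ ≤ ε / (2 * (σ₁ - σ₂ + 1)) * (σ₁ - σ₂) + ε / (2 * (σ₁ - σ₂ + 1)) * (σ₁ - σ₂) :=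
        add_le_add e₂ e₁
    _ = ε * ((σ₁ - σ₂) / (σ₁ - σ₂ + 1)) := by field_simp; ring
    _ < ε * 1 := by
        refine mul_lt_mul_of_pos_left ?_ hε
        rw [div_lt_one h3]; linarith
    _ = ε := mul_one ε

theorem integrable_vertical {F : ℂ → ℂ} {σ : ℝ} {C Y : ℝ}
    (hd : ∀ s : ℂ, s.re = σ → DifferentiableAt ℂ F s)
    (hdec : ∀ s : ℂ, s.re = σ → Y ≤ |s.im| → ‖F s‖ ≤ C / s.im ^ 2) :
    Integrable fun y : ℝ => F (σ + y * Complex.I) := by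
  refine integrable_of_decay (C := C) (Y := Y) ?_ fun y hy => ?_
  · refine continuous_iff_continuousAt.2 fun y => ?_
    have h1 : ContinuousAt F ((σ : ℂ) + y * Complex.I) := (hd _ (by simp)).continuousAt
    exact ContinuousAt.comp (f := fun y : ℝ => (σ : ℂ) + y * Complex.I) h1 (by fun_prop)
  · simpa using hdec (σ + y * Complex.I) (by simp) (by simpa using hy)

/-- The residue theorem for a vertical strip. -/
theorem integral_vertical_sub {F : ℂ → ℂ} {σ₁ σ₂ : ℝ} (h : σ₂ ≤ σ₁) (S : Finset ℂ)
    (hS : ∀ z ∈ S, σ₂ < z.re ∧ z.re < σ₁)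
    (hd : ∀ s : ℂ, s.re ∈ Set.Icc σ₂ σ₁ → s ∉ S → DifferentiableAt ℂ F s)
    {C Y : ℝ} (hdec : ∀ s : ℂ, s.re ∈ Set.Icc σ₂ σ₁ → Y ≤ |s.im| → ‖F s‖ ≤ C / s.im ^ 2)
    (l : ℂ → ℕ) (hl : ∀ z ∈ S, 1 ≤ l z) (a : ℂ → ℕ → ℂ)
    (hpp : ∀ z ∈ S, HasPrincipalPart F z (l z) (a z)) :
    (∫ y : ℝ, F (σ₁ + y * Complex.I)) - ∫ y : ℝ, F (σ₂ + y * Complex.I) =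
      2 * π * ∑ z ∈ S, a z 1 := by
  -- F minus all its principal parts extends to a function `G` holomorphic on the strip, whose edge
  -- integrals agree in the limit. The contribution of `P` is computed term by term, always as a
  -- difference of the two edges, since its simple polar terms are not integrable on one edge.
  set P : ℂ → ℂ := fun s => ∑ z ∈ S, ∑ k ∈ Finset.Icc 1 (l z), a z k * ((s - z) ^ k)⁻¹ with hP
  have hterm : ∀ (z s : ℂ) (k : ℕ), s ≠ z →
      DifferentiableAt ℂ (fun s => a z k * ((s - z) ^ k)⁻¹) s := fun z s k hs => by
    have hsz : s - z ≠ 0 := sub_ne_zero.2 hs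
    fun_prop (disch := simp [hsz])
  have hPd : ∀ s ∉ S, DifferentiableAt ℂ P s := fun s hs => by
    refine DifferentiableAt.fun_sum fun z hz => DifferentiableAt.fun_sum fun k _ => hterm z s k ?_
    rintro rfl
    exact hs hz
  have hpun : ∀ z : ℂ, ∀ᶠ s in 𝓝[≠] z, s ∉ S := fun z => by
    have h1 : ((S : Set ℂ) \ {z})ᶜ ∈ 𝓝 z :=
      (S.finite_toSet.subset Set.sdiff_subset).isClosed.isOpen_compl.mem_nhds (by simp)
    filter_upwards [nhdsWithin_le_nhds h1, self_mem_nhdsWithin] with s hs hs' hsS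
    exact hs ⟨hsS, hs'⟩
  obtain ⟨G, hGd, hGF⟩ := exists_differentiable_extension (f := fun s => F s - P s)
    (U := {s : ℂ | s.re ∈ Set.Icc σ₂ σ₁}) (S := S) S.finite_toSet
    (fun s hs hsS => (hd s hs hsS).sub (hPd s hsS))
    (fun z hz => by
      have h1 : {s : ℂ | σ₂ < s.re ∧ s.re < σ₁} ∈ 𝓝 z :=
        ((isOpen_lt continuous_const Complex.continuous_re).inter
          (isOpen_lt Complex.continuous_re continuous_const)).mem_nhds (hS z hz)
      filter_upwards [nhdsWithin_le_nhds h1, hpun z] with s hs hsS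
      exact (hd s ⟨hs.1.le, hs.2.le⟩ hsS).sub (hPd s hsS))
    (fun z hz => by
      classical
      have e : (fun s => F s - P s) = fun s =>
          (F s - ∑ k ∈ Finset.Icc 1 (l z), a z k / (s - z) ^ k) -
          ∑ w ∈ S.erase z, ∑ k ∈ Finset.Icc 1 (l w), a w k * ((s - w) ^ k)⁻¹ := by
        funext s
        simp only [hP]
        rw [← Finset.add_sum_erase S _ hz]
        simp only [div_eq_mul_inv]
        ring
      rw [e]
      refine (hpp z hz).isBigO_sub.sub ?_
      have hc : ContinuousAt (fun s =>
          ∑ w ∈ S.erase z, ∑ k ∈ Finset.Icc 1 (l w), a w k * ((s - w) ^ k)⁻¹) z :=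
        (DifferentiableAt.fun_sum fun w hw => DifferentiableAt.fun_sum fun k _ =>
          hterm w z k (Finset.ne_of_mem_erase hw).symm).continuousAt
      exact (hc.tendsto.mono_left nhdsWithin_le_nhds).isBigO_one ℝ)
  have hσ₁ : σ₁ ∈ Set.Icc σ₂ σ₁ := ⟨h, le_rfl⟩
  have hσ₂ : σ₂ ∈ Set.Icc σ₂ σ₁ := ⟨le_rfl, h⟩
  have hn₁ : ∀ s : ℂ, s.re = σ₁ → s ∉ S := fun s hs hsS => (hS s hsS).2.ne hs
  have hn₂ : ∀ s : ℂ, s.re = σ₂ → s ∉ S := fun s hs hsS => (hS s hsS).1.ne' hs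
  have i₁ : Integrable fun y : ℝ => F (σ₁ + y * Complex.I) :=
    integrable_vertical (fun s hs => hd s (hs ▸ hσ₁) (hn₁ s hs)) fun s hs => hdec s (hs ▸ hσ₁)
  have i₂ : Integrable fun y : ℝ => F (σ₂ + y * Complex.I) :=
    integrable_vertical (fun s hs => hd s (hs ▸ hσ₂) (hn₂ s hs)) fun s hs => hdec s (hs ▸ hσ₂)
  have hPi : Integrable (fun y : ℝ => P (σ₁ + y * Complex.I) - P (σ₂ + y * Complex.I)) ∧
      ∫ y : ℝ, (P (σ₁ + y * Complex.I) - P (σ₂ + y * Complex.I)) = 2 * π * ∑ z ∈ S, a z 1 := by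
    have e : (fun y : ℝ => P (σ₁ + y * Complex.I) - P (σ₂ + y * Complex.I)) = fun y : ℝ =>
        ∑ z ∈ S, ∑ k ∈ Finset.Icc 1 (l z), a z k * (((((σ₁ : ℂ) + y * Complex.I) - z) ^ k)⁻¹
          - ((((σ₂ : ℂ) + y * Complex.I) - z) ^ k)⁻¹) := by
      funext y
      simp only [hP, ← Finset.sum_sub_distrib, mul_sub]
    have hi : ∀ z ∈ S, ∀ k ∈ Finset.Icc 1 (l z), Integrable fun y : ℝ =>
        a z k * (((((σ₁ : ℂ) + y * Complex.I) - z) ^ k)⁻¹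
          - ((((σ₂ : ℂ) + y * Complex.I) - z) ^ k)⁻¹) := fun z hz k hk =>
      (integral_inv_pow_vertical_sub (hS z hz).2 (hS z hz).1
        (Finset.mem_Icc.1 hk).1).1.const_mul _
    rw [e]
    refine ⟨integrable_finsetSum _ fun z hz => integrable_finsetSum _ fun k hk => hi z hz k hk, ?_⟩
    rw [integral_finsetSum _ fun z hz => integrable_finsetSum _ fun k hk => hi z hz k hk,
      Finset.mul_sum]
    refine Finset.sum_congr rfl fun z hz => ?_
    rw [integral_finsetSum _ fun k hk => hi z hz k hk]
    have : ∀ k ∈ Finset.Icc 1 (l z), ∫ y : ℝ,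
        a z k * (((((σ₁ : ℂ) + y * Complex.I) - z) ^ k)⁻¹
          - ((((σ₂ : ℂ) + y * Complex.I) - z) ^ k)⁻¹) =
        if k = 1 then 2 * π * a z 1 else 0 := fun k hk => by
      rw [integral_const_mul, (integral_inv_pow_vertical_sub (hS z hz).2 (hS z hz).1
        (Finset.mem_Icc.1 hk).1).2]
      split_ifs with hk1
      · rw [hk1, mul_comm]
      · rw [mul_zero]
    rw [Finset.sum_congr rfl this, Finset.sum_ite_eq',
      if_pos (Finset.mem_Icc.2 ⟨le_rfl, hl z hz⟩)]
  have hG₁ : ∀ y : ℝ, G (σ₁ + y * Complex.I) = F (σ₁ + y * Complex.I) - P (σ₁ + y * Complex.I) :=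
    fun y => hGF _ (hn₁ _ (by simp))
  have hG₂ : ∀ y : ℝ, G (σ₂ + y * Complex.I) = F (σ₂ + y * Complex.I) - P (σ₂ + y * Complex.I) :=
    fun y => hGF _ (hn₂ _ (by simp))
  have hGe : (fun y : ℝ => G (σ₁ + y * Complex.I) - G (σ₂ + y * Complex.I)) = fun y : ℝ =>
      (F (σ₁ + y * Complex.I) - F (σ₂ + y * Complex.I)) -
        (P (σ₁ + y * Complex.I) - P (σ₂ + y * Complex.I)) := by
    funext y
    rw [hG₁, hG₂]
    ring
  have hGi : Integrable fun y : ℝ => G (σ₁ + y * Complex.I) - G (σ₂ + y * Complex.I) := by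
    rw [hGe]
    exact (i₁.sub i₂).sub hPi.1
  have hlim := intervalIntegral_tendsto_integral hGi tendsto_neg_atTop_atBot tendsto_id
  -- Away from the heights of the poles, F is bounded by its quadratic decay and each polar term by
  -- a negative power of |Im s| - |Im z|, uniformly on the strip.
  have h0 := tendsto_integral_edges h (fun s hs => hGd s (Or.inl hs)) (fun ε hε => by
    have hFl : Tendsto (fun y : ℝ => |C| / y ^ 2) atTop (𝓝 0) :=
      tendsto_const_nhds.div_atTop (tendsto_pow_atTop two_ne_zero)
    have hPl : Tendsto (fun y : ℝ => ∑ z ∈ S, ∑ k ∈ Finset.Icc 1 (l z),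
        ‖a z k‖ * ((y - |z.im|) ^ k)⁻¹) atTop (𝓝 0) := by
      have : Tendsto (fun y : ℝ => ∑ z ∈ S, ∑ k ∈ Finset.Icc 1 (l z),
          ‖a z k‖ * ((y - |z.im|) ^ k)⁻¹) atTop
          (𝓝 (∑ z ∈ S, ∑ k ∈ Finset.Icc 1 (l z), ‖a z k‖ * 0)) := by
        refine tendsto_finsetSum _ fun z _ => tendsto_finsetSum _ fun k hk =>
          Tendsto.const_mul _ (tendsto_inv_atTop_zero.comp ((tendsto_pow_atTop
            (by have := (Finset.mem_Icc.1 hk).1; omega)).comp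
              (tendsto_atTop_add_const_right _ _ tendsto_id)))
      simpa using this
    have hsum := hFl.add hPl
    rw [add_zero] at hsum
    obtain ⟨Y', hY'⟩ := eventually_atTop.1 (((hsum.eventually (gt_mem_nhds hε)).and
      (eventually_ge_atTop Y)).and (eventually_gt_atTop (∑ z ∈ S, |z.im|)))
    refine ⟨Y', fun s hs hsY => ?_⟩
    obtain ⟨⟨hy1, hy2⟩, hy3⟩ := hY' |s.im| hsY
    have hz_lt : ∀ z ∈ S, |z.im| < |s.im| := fun z hz =>
      (Finset.single_le_sum (f := fun z : ℂ => |z.im|) (fun w _ => abs_nonneg _) hz).trans_lt hy3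
    have hsS : s ∉ S := fun hsS => (hz_lt s hsS).ne rfl
    rw [hGF s hsS]
    refine (norm_sub_le _ _).trans (le_trans ?_ hy1.le)
    refine add_le_add ?_ ?_
    · refine (hdec s hs hy2).trans ?_
      rw [sq_abs]
      gcongr
      exact le_abs_self C
    · refine (norm_sum_le _ _).trans (Finset.sum_le_sum fun z hz =>
        (norm_sum_le _ _).trans (Finset.sum_le_sum fun k _ => ?_))
      rw [norm_mul, norm_inv, norm_pow]
      have h1 : 0 < |s.im| - |z.im| := sub_pos.2 (hz_lt z hz)
      have h2 : |s.im| - |z.im| ≤ ‖s - z‖ :=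
        ((abs_sub_abs_le_abs_sub _ _).trans (by rw [← Complex.sub_im])).trans
          (Complex.abs_im_le_norm (s - z))
      gcongr)
  have hz := tendsto_nhds_unique hlim h0
  have i₃ : Integrable fun y : ℝ => F (σ₁ + y * Complex.I) - F (σ₂ + y * Complex.I) := i₁.sub i₂
  rw [hGe, integral_sub i₃ hPi.1, hPi.2, integral_sub i₁ i₂] at hz
  exact sub_eq_zero.1 hz

/-! ### Decay of Γ and of the Γ-factor on vertical strips. -/

theorem norm_Gamma_le {s : ℂ} (hs : 0 < s.re) : ‖Complex.Gamma s‖ ≤ Real.Gamma s.re := by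
  rw [Complex.Gamma_eq_integral hs, Real.Gamma_eq_integral hs, Complex.GammaIntegral]
  refine (norm_integral_le_integral_norm _).trans_eq ?_
  refine setIntegral_congr_fun measurableSet_Ioi fun x hx => ?_
  have hx : 0 < x := hx
  simp only [norm_mul, Complex.norm_real, Real.norm_eq_abs, Real.abs_exp]
  rw [Complex.norm_cpow_eq_rpow_re_of_pos hx]
  simp

/-- Γ(s + n) = s(s + 1)⋯(s + n - 1) Γ(s), and every factor has modulus at least |Im s|. This gives
decay of any polynomial order, and also to the left of the imaginary axis. -/
theorem norm_Gamma_mul_abs_im_pow_le (n : ℕ) {s : ℂ} (hs : 0 < s.re + n) (hi : 0 < |s.im|) :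
    ‖Complex.Gamma s‖ * |s.im| ^ n ≤ Real.Gamma (s.re + n) := by
  induction n generalizing s with
  | zero => simpa using norm_Gamma_le (by simpa using hs)
  | succ n ih =>
    have hs0 : s ≠ 0 := fun h => by simp [h] at hi
    have h1 := ih (s := s + 1) (by simp; push_cast at hs; linarith) (by simpa using hi)
    rw [Complex.Gamma_add_one s hs0, norm_mul] at h1
    have e : (s + 1).re + n = s.re + ((n + 1 : ℕ) : ℝ) := by simp; ring
    have e' : (s + 1).im = s.im := by simp
    rw [e, e'] at h1
    refine le_trans ?_ h1
    have := Complex.abs_im_le_norm s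
    calc ‖Complex.Gamma s‖ * |s.im| ^ (n + 1) = |s.im| * ‖Complex.Gamma s‖ * |s.im| ^ n := by ring
      _ ≤ _ := by gcongr

theorem exists_Gamma_decay (a b : ℝ) : ∃ C, 0 ≤ C ∧ ∀ s : ℂ, s.re ∈ Set.Icc a b → 1 ≤ |s.im| →
    ‖Complex.Gamma s‖ ≤ C / s.im ^ 2 := by
  obtain ⟨n, hn⟩ := exists_nat_gt (-a)
  -- Shifting by `n` already brings the strip into Re s > 0; the extra 2 ensures that the exponent
  -- of |Im s| is at least 2.
  set N := n + 2 with hN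
  have hNpos : 0 < a + N := by push_cast [hN]; linarith
  obtain ⟨M, hM⟩ := (isCompact_Icc (a := a + N) (b := b + N)).exists_bound_of_continuousOn
    (f := Real.Gamma) (fun x hx =>
      (Real.differentiableOn_Gamma_Ioi.differentiableAt
        (Ioi_mem_nhds (hNpos.trans_le hx.1))).continuousAt.continuousWithinAt)
  refine ⟨|M|, abs_nonneg _, fun s hs hi => ?_⟩
  have hi0 : 0 < |s.im| := by linarith
  rw [le_div_iff₀ (by rw [← sq_abs]; positivity)]
  have h1 := norm_Gamma_mul_abs_im_pow_le N (s := s) (by linarith [hs.1]) hi0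
  have h2 := hM (s.re + N) ⟨by linarith [hs.1], by linarith [hs.2]⟩
  calc ‖Complex.Gamma s‖ * s.im ^ 2 = ‖Complex.Gamma s‖ * |s.im| ^ 2 := by rw [sq_abs]
    _ ≤ ‖Complex.Gamma s‖ * |s.im| ^ N := by
        exact mul_le_mul_of_nonneg_left (pow_le_pow_right₀ hi (by omega)) (norm_nonneg _)
    _ ≤ _ := h1
    _ ≤ _ := (le_abs_self _).trans (h2.trans (le_abs_self _))

section

variable {d : ℕ} (lam : Fin d → ℂ)

theorem exists_gammaFactor_decay (hd : 1 ≤ d) (a b : ℝ) :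
    ∃ C Y, ∀ s : ℂ, s.re ∈ Set.Icc a b → Y ≤ |s.im| → ‖gammaFactor lam s‖ ≤ C / s.im ^ 2 := by
  choose C hC0 hC using fun k : Fin d => exists_Gamma_decay ((a + (lam k).re) / 2)
    ((b + (lam k).re) / 2)
  -- This height forces |Im ((s + λₖ)/2)| ≥ |Im s| / 4 ≥ 1, whence the factor 16 = 4². All d factors
  -- decay; as d ≥ 1 and (Im s)² ≥ 1, one power of (Im s)⁻² is kept.
  refine ⟨∏ k, (C k * 16), ∑ k, 2 * |(lam k).im| + 4, fun s hs hY => ?_⟩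
  have h4 : 4 ≤ |s.im| :=
    le_trans (le_add_of_nonneg_left (Finset.sum_nonneg fun k _ => by positivity)) hY
  have hsq : 1 ≤ s.im ^ 2 := by rw [← sq_abs]; nlinarith
  have hk : ∀ k, ‖Complex.Gamma ((s + lam k) / 2)‖ ≤ C k * 16 / s.im ^ 2 := fun k => by
    have h2 : 2 * |(lam k).im| ≤ |s.im| := by
      have := Finset.single_le_sum (f := fun k => 2 * |(lam k).im|) (fun w _ => by positivity)
        (Finset.mem_univ k)
      linarith
    have him : ((s + lam k) / 2).im = (s.im + (lam k).im) / 2 := by simp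
    have hre : ((s + lam k) / 2).re = (s.re + (lam k).re) / 2 := by simp
    have h3 : |s.im| / 4 ≤ |((s + lam k) / 2).im| := by
      rw [him, abs_div, abs_two]
      have := abs_sub_abs_le_abs_sub s.im (-(lam k).im)
      rw [abs_neg, sub_neg_eq_add] at this
      linarith
    have h5 := hC k ((s + lam k) / 2) (by rw [hre]; constructor <;> linarith [hs.1, hs.2])
      (by linarith)
    refine h5.trans ?_
    rw [mul_div_assoc]
    rw [← mul_one_div (C k)]
    refine mul_le_mul_of_nonneg_left ?_ (hC0 k)
    rw [div_le_div_iff₀ (by rw [← sq_abs]; have : 0 < |s.im| / 4 := by linarith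
                            have := this.trans_le h3; positivity) (by linarith), one_mul]
    have := pow_le_pow_left₀ (by positivity) h3 2
    rw [sq_abs, div_pow, sq_abs] at this
    linarith
  rw [gammaFactor, norm_prod]
  calc _ ≤ ∏ k, (C k * 16 / s.im ^ 2) := Finset.prod_le_prod (fun k _ => norm_nonneg _) fun k _ => hk k
    _ = (∏ k, (C k * 16)) / (s.im ^ 2) ^ d := by
        rw [Finset.prod_div_distrib, Finset.prod_const, Finset.card_univ, Fintype.card_fin]
    _ ≤ _ := by
        refine div_le_div_of_nonneg_left
          (Finset.prod_nonneg fun k _ => mul_nonneg (hC0 k) (by norm_num)) (by linarith) ?_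
        exact le_self_pow₀ hsq (by omega)

theorem gammaFactor_sub_two (s : ℂ) :
    gammaFactor lam (s - 2) = gammaFactor lam s / ∏ k, ((s + lam k) / 2 - 1) := by
  rw [gammaFactor, gammaFactor, ← Finset.prod_div_distrib]
  refine Finset.prod_congr rfl fun k _ => ?_
  have e : (s - 2 + lam k) / 2 = (s + lam k) / 2 - 1 := by ring
  rw [e]
  -- At this pole both sides are 0 under the conventions Γ(0) = 0 and x / 0 = 0, so the identity
  -- needs no exceptions.
  by_cases h : (s + lam k) / 2 - 1 = 0
  · rw [h, Complex.Gamma_zero, div_zero]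
  · have := Complex.Gamma_add_one _ h
    rw [sub_add_cancel] at this
    rw [this, mul_div_cancel_left₀ _ h]

theorem differentiableAt_gammaFactor {s : ℂ} (h : ∀ k, ∀ n : ℕ, s ≠ -lam k - 2 * n) :
    DifferentiableAt ℂ (gammaFactor lam) s := by
  have h1 : ∀ k ∈ Finset.univ,
      DifferentiableAt ℂ (fun s => Complex.Gamma ((s + lam k) / 2)) s := fun k _ => by
    have hG : DifferentiableAt ℂ Complex.Gamma ((s + lam k) / 2) :=
      Complex.differentiableAt_Gamma _ fun n hn => h k n (by linear_combination 2 * hn)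
    exact DifferentiableAt.comp s hG (by fun_prop)
  exact DifferentiableAt.fun_finsetProd h1

theorem differentiableAt_gammaFactor_of_re {s : ℂ} (h : ∀ k, 0 < s.re + (lam k).re) :
    DifferentiableAt ℂ (gammaFactor lam) s :=
  differentiableAt_gammaFactor lam fun k n hn => by
    have := h k
    rw [hn] at this
    simp at this
    linarith [(Nat.cast_nonneg n : (0 : ℝ) ≤ n)]

/-! ### The inverse Mellin transform of the Γ-factor and its inversion. -/

/-- The integrand of the inverse Mellin transform. -/
noncomputable def mellinIntegrand (t : ℝ) (s : ℂ) : ℂ := gammaFactor lam s * (t : ℂ) ^ (-s)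

theorem mellinInv_gammaFactor (σ t : ℝ) : mellinInv σ (gammaFactor lam) t =
    (2 * (π : ℂ))⁻¹ * ∫ y : ℝ, mellinIntegrand lam t (σ + y * Complex.I) := by
  simp only [mellinInv, mellinIntegrand, smul_eq_mul, Complex.real_smul]
  congr 1
  · push_cast; rw [one_div]
  · simp only [mul_comm]

theorem differentiableAt_cpow_neg {t : ℝ} (ht : 0 < t) (s : ℂ) :
    DifferentiableAt ℂ (fun s : ℂ => (t : ℂ) ^ (-s)) s :=
  DifferentiableAt.const_cpow (by fun_prop) (Or.inl (by exact_mod_cast ht.ne'))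

theorem exists_mellinIntegrand_decay (hd : 1 ≤ d) {t : ℝ} (ht : 0 < t) (a b : ℝ) :
    ∃ C Y, ∀ s : ℂ, s.re ∈ Set.Icc a b → Y ≤ |s.im| → ‖mellinIntegrand lam t s‖ ≤ C / s.im ^ 2 := by
  obtain ⟨C, Y, h⟩ := exists_gammaFactor_decay lam hd a b
  obtain ⟨M, hM⟩ := (isCompact_Icc (a := a) (b := b)).exists_bound_of_continuousOn
    (f := fun x => t ^ (-x)) (fun x _ =>
      ((Real.continuousAt_const_rpow ht.ne').comp continuousAt_neg).continuousWithinAt)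
  refine ⟨C * M, Y, fun s hs hY => ?_⟩
  rw [mellinIntegrand, norm_mul, Complex.norm_cpow_eq_rpow_re_of_pos ht, mul_div_right_comm]
  have h1 := h s hs hY
  have h2 := (le_abs_self _).trans (hM _ hs)
  rw [Complex.neg_re]
  exact mul_le_mul h1 h2 (by positivity) ((norm_nonneg _).trans h1)

theorem verticalIntegrable_gammaFactor (hd : 1 ≤ d) {σ : ℝ}
    (h : ∀ k, ∀ n : ℕ, σ ≠ -(lam k).re - 2 * n) :
    Complex.VerticalIntegrable (gammaFactor lam) σ := by
  obtain ⟨C, Y, hC⟩ := exists_gammaFactor_decay lam hd σ σ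
  refine integrable_vertical (C := C) (Y := Y) (fun s hs => ?_) fun s hs => hC s (by simp [hs])
  refine differentiableAt_gammaFactor lam fun k n hn => h k n ?_
  rw [← hs, hn]
  simp

theorem ne_pole_of_pos {σ : ℝ} (hσ : ∀ k, 0 < σ + (lam k).re) (k : Fin d) (n : ℕ) :
    σ ≠ -(lam k).re - 2 * n := by
  have := hσ k
  have : (0 : ℝ) ≤ n := Nat.cast_nonneg n
  intro h
  linarith

/-- The residue theorem for a strip without poles. -/
theorem mellinInv_gammaFactor_eq (hd : 1 ≤ d) {σ₁ σ₂ : ℝ} (h₁ : ∀ k, 0 < σ₁ + (lam k).re)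
    (h₂ : ∀ k, 0 < σ₂ + (lam k).re) {t : ℝ} (ht : 0 < t) :
    mellinInv σ₁ (gammaFactor lam) t = mellinInv σ₂ (gammaFactor lam) t := by
  wlog h : σ₂ ≤ σ₁ generalizing σ₁ σ₂
  · exact (this h₂ h₁ (le_of_not_ge h)).symm
  obtain ⟨C, Y, hC⟩ := exists_mellinIntegrand_decay lam hd ht σ₂ σ₁
  have := integral_vertical_sub (F := mellinIntegrand lam t) h ∅ (by simp)
    (fun s hs _ => (differentiableAt_gammaFactor_of_re lam
      fun k => (h₂ k).trans_le (by linarith [hs.1])).mul (differentiableAt_cpow_neg ht s))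
    hC (fun _ => 1) (by simp) (fun _ _ => 0) (by simp)
  rw [Finset.sum_empty, mul_zero, sub_eq_zero] at this
  rw [mellinInv_gammaFactor, mellinInv_gammaFactor, this]

theorem norm_mellinInv_gammaFactor_le (σ : ℝ) {t : ℝ} (ht : 0 < t) :
    ‖mellinInv σ (gammaFactor lam) t‖ ≤
      (2 * π)⁻¹ * (∫ y : ℝ, ‖gammaFactor lam (σ + y * Complex.I)‖) * t ^ (-σ) := by
  rw [mellinInv_gammaFactor, norm_mul, mul_assoc]
  have e : ‖(2 * (π : ℂ))⁻¹‖ = (2 * π)⁻¹ := by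
    rw [norm_inv, norm_mul, Complex.norm_real, Real.norm_of_nonneg Real.pi_pos.le]; simp
  rw [e]
  have hpi := Real.pi_pos
  gcongr
  refine (norm_integral_le_integral_norm _).trans_eq ?_
  rw [← integral_mul_const]
  congr 1
  funext y
  rw [mellinIntegrand, norm_mul, Complex.norm_cpow_eq_rpow_re_of_pos ht]
  simp

/-- After the substitution t = e^{-u} on the line through Re s, `φ` becomes the inverse Fourier
transform `h` of `γ` restricted to that line. Estimating `φ` on the lines Re s ± ε gives exponential
decay of `h` in both directions, so `h` is integrable and Fourier inversion applies. -/
theorem hasMellin_mellinInv_gammaFactor (hd : 1 ≤ d) {σ : ℝ} (hσ : ∀ k, 0 < σ + (lam k).re)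
    {s : ℂ} (hs : ∀ k, 0 < (s + lam k).re) :
    HasMellin (mellinInv σ (gammaFactor lam)) s (gammaFactor lam s) := by
  set φ := mellinInv σ (gammaFactor lam) with hφ
  have hs' : ∀ k, 0 < s.re + (lam k).re := fun k => by simpa using hs k
  obtain ⟨ε, hε0, hε⟩ : ∃ ε : ℝ, 0 < ε ∧ ∀ k, 0 < (s.re - ε) + (lam k).re := by
    have h1 : ∀ᶠ ε : ℝ in 𝓝[>] 0, ∀ k, 0 < (s.re - ε) + (lam k).re := by
      refine eventually_all.2 fun k => ?_
      filter_upwards [Ioo_mem_nhdsGT (hs' k)] with ε h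
      linarith [h.2]
    obtain ⟨ε, h2, h3⟩ := (h1.and self_mem_nhdsWithin).exists
    exact ⟨ε, h3, h2⟩
  have hε' : ∀ k, 0 < (s.re + ε) + (lam k).re := fun k => by linarith [hs' k]
  have hbound : ∀ σ' : ℝ, (∀ k, 0 < σ' + (lam k).re) →
      ∃ K, ∀ t, 0 < t → ‖φ t‖ ≤ K * t ^ (-σ') := fun σ' h' =>
    ⟨_, fun t ht => by
      rw [hφ, mellinInv_gammaFactor_eq lam hd hσ h' ht]
      exact norm_mellinInv_gammaFactor_le lam σ' ht⟩
  obtain ⟨K₁, hK₁⟩ := hbound _ hε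
  obtain ⟨K₂, hK₂⟩ := hbound _ hε'
  set g : ℝ → ℂ := fun y => gammaFactor lam (s.re + 2 * π * y * Complex.I) with hg
  have hgc : Continuous g := continuous_iff_continuousAt.2 fun y => by
    have h1 : ContinuousAt (gammaFactor lam) ((s.re : ℂ) + 2 * π * y * Complex.I) :=
      (differentiableAt_gammaFactor_of_re lam fun k => by simpa using hs' k).continuousAt
    exact ContinuousAt.comp (f := fun y : ℝ => (s.re : ℂ) + 2 * π * y * Complex.I) h1 (by fun_prop)
  have hgi : Integrable g := by
    have h1 : Integrable fun y : ℝ => gammaFactor lam (s.re + y * Complex.I) :=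
      verticalIntegrable_gammaFactor lam hd (ne_pole_of_pos lam hs')
    have h2 := h1.comp_mul_left' (R := 2 * π) (by positivity)
    refine h2.congr (ae_of_all _ fun y => ?_)
    simp [hg]
  set h : ℝ → ℂ := FourierTransformInv.fourierInv g with hh
  have hφh : ∀ t : ℝ, 0 < t → φ t = (t : ℂ) ^ (-(s.re : ℂ)) * h (-Real.log t) := fun t ht => by
    rw [hφ, mellinInv_gammaFactor_eq lam hd hσ hs' ht, mellinInv_eq_fourierInv _ _ ht, smul_eq_mul]
  have hhu : ∀ u : ℝ, Real.exp (-s.re * u) • φ (Real.exp (-u)) = h u := fun u => by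
    rw [hφh _ (Real.exp_pos _), Real.log_exp, neg_neg, Complex.real_smul, ← mul_assoc]
    have : ((Real.exp (-u) : ℝ) : ℂ) ^ (-(s.re : ℂ)) = ((Real.exp (s.re * u) : ℝ) : ℂ) := by
      rw [← Complex.ofReal_neg, ← Complex.ofReal_cpow (Real.exp_pos _).le, ← Real.exp_mul]
      congr 2; ring
    rw [this, ← Complex.ofReal_mul, ← Real.exp_add]
    simp
  have hhc : Continuous h := by
    have h1 : Continuous (FourierTransform.fourier g) :=
      VectorFourier.fourierIntegral_continuous Real.continuous_fourierChar
        (by fun_prop) hgi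
    have h2 : h = fun u => FourierTransform.fourier g (-u) := by
      funext u
      rw [hh, Real.fourierInv_eq_fourier_neg]
    rw [h2]
    exact h1.comp continuous_neg
  have hhb₁ : ∀ u : ℝ, ‖h u‖ ≤ K₁ * Real.exp (-ε * u) := fun u => by
    rw [← hhu, norm_smul, Real.norm_of_nonneg (Real.exp_pos _).le]
    have h1 := hK₁ _ (Real.exp_pos (-u))
    rw [← Real.exp_mul] at h1
    refine (mul_le_mul_of_nonneg_left h1 (Real.exp_pos _).le).trans_eq ?_
    rw [mul_left_comm, ← Real.exp_add]
    ring_nf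
  have hhb₂ : ∀ u : ℝ, ‖h u‖ ≤ K₂ * Real.exp (ε * u) := fun u => by
    rw [← hhu, norm_smul, Real.norm_of_nonneg (Real.exp_pos _).le]
    have h1 := hK₂ _ (Real.exp_pos (-u))
    rw [← Real.exp_mul] at h1
    refine (mul_le_mul_of_nonneg_left h1 (Real.exp_pos _).le).trans_eq ?_
    rw [mul_left_comm, ← Real.exp_add]
    ring_nf
  have hhi : Integrable h := by
    -- The constant 2 / ε² comes from e^x ≥ x² / 2 at x = ε|u|.
    refine integrable_of_decay (C := max K₁ K₂ * (2 / ε ^ 2)) (Y := 1) hhc fun u hu => ?_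
    have h1 : ‖h u‖ ≤ max K₁ K₂ * Real.exp (-(ε * |u|)) := by
      rcases abs_cases u with ⟨h2, -⟩ | ⟨h2, -⟩
      · rw [h2]
        refine (hhb₁ u).trans ?_
        rw [← neg_mul]
        gcongr
        exact le_max_left _ _
      · rw [h2, mul_neg, neg_neg]
        refine (hhb₂ u).trans ?_
        gcongr
        exact le_max_right _ _
    have hu0 : 0 < |u| := by linarith
    have hmax : 0 ≤ max K₁ K₂ :=
      nonneg_of_mul_nonneg_left ((norm_nonneg _).trans h1) (Real.exp_pos _)
    refine h1.trans ?_
    rw [mul_div_assoc]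
    refine mul_le_mul_of_nonneg_left ?_ hmax
    have h3 := Real.quadratic_le_exp_of_nonneg (x := ε * |u|) (by positivity)
    rw [Real.exp_neg, ← sq_abs u, div_div, ← one_div,
      div_le_div_iff₀ (Real.exp_pos _) (by positivity)]
    nlinarith [mul_pos hε0 hu0]
  constructor
  · refine mellinConvergent_of_isBigO_rpow (a := s.re + ε) (b := s.re - ε) ?_ ?_ (by linarith) ?_
      (by linarith)
    · refine ContinuousOn.locallyIntegrableOn ?_ measurableSet_Ioi
      intro t ht
      have ht : 0 < t := ht
      have h1 : ContinuousAt (fun t : ℝ => (t : ℂ) ^ (-(s.re : ℂ)) * h (-Real.log t)) t := by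
        refine ContinuousAt.mul ?_ ?_
        · exact Complex.continuousAt_ofReal_cpow_const _ _ (Or.inr ht.ne')
        · exact hhc.continuousAt.comp (Real.continuousAt_log ht.ne').neg
      refine (h1.congr ?_).continuousWithinAt
      filter_upwards [lt_mem_nhds ht] with x hx
      exact (hφh x hx).symm
    · refine IsBigO.of_bound K₂ ?_
      filter_upwards [eventually_gt_atTop 0] with t ht
      rw [Real.norm_of_nonneg (by positivity)]
      exact hK₂ t ht
    · refine IsBigO.of_bound K₁ ?_
      filter_upwards [self_mem_nhdsWithin] with t ht
      have ht : 0 < t := ht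
      rw [Real.norm_of_nonneg (by positivity)]
      exact hK₁ t ht
  · rw [mellin_eq_fourier]
    have e : (fun u => Real.exp (-s.re * u) • φ (Real.exp (-u))) = h := funext hhu
    rw [e]
    have hFi : Integrable (FourierTransform.fourier g) := by
      have h2 : FourierTransform.fourier g = fun u => h (-u) := by
        funext u
        rw [hh, Real.fourierInv_eq_fourier_neg, neg_neg]
      rw [h2]
      exact hhi.comp_neg
    rw [hh, hgi.fourier_fourierInv_eq hFi hgc.continuousAt]
    simp only [hg]
    congr 1
    conv_rhs => rw [← Complex.re_add_im s]
    push_cast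
    have : (π : ℂ) ≠ 0 := by exact_mod_cast Real.pi_ne_zero
    field_simp

end

/-! ### Laurent expansions and the recursion for the principal parts. -/

/-- The linear polynomial `s / 2 + b` as a Laurent series. -/
noncomputable def lin (b : ℂ) : LaurentSeries ℂ := HahnSeries.single (1 : ℤ) (1 / 2 : ℂ) + HahnSeries.C b

theorem half_sub_natCast_eq_lin (a : ℂ) (n : ℕ) :
    (HahnSeries.single (1 : ℤ) (1 : ℂ) + HahnSeries.C a) / 2 - (n : LaurentSeries ℂ) =
      lin (a / 2 - n) := by
  have h2 : (2 : LaurentSeries ℂ) = HahnSeries.C 2 := (map_ofNat HahnSeries.C 2).symm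
  have h20 : (2 : LaurentSeries ℂ) ≠ 0 := by
    rw [h2]
    exact HahnSeries.C_ne_zero two_ne_zero
  have hn : (n : LaurentSeries ℂ) = HahnSeries.C (n : ℂ) := (map_natCast HahnSeries.C n).symm
  rw [lin, sub_eq_iff_eq_add, div_eq_iff h20, hn, add_assoc, ← map_add, mul_two]
  ext i
  simp only [HahnSeries.coeff_add, HahnSeries.coeff_single, HahnSeries.C_apply]
  split_ifs <;> ring

theorem coeff_mul_lin (g : LaurentSeries ℂ) (b : ℂ) (i : ℤ) :
    (g * lin b).coeff i = b * g.coeff i + g.coeff (i - 1) / 2 := by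
  rw [lin, mul_add, HahnSeries.coeff_add, HahnSeries.coeff_mul_single, HahnSeries.C_apply,
    HahnSeries.coeff_mul_single, sub_zero]
  ring

theorem lin_ne_zero (b : ℂ) : lin b ≠ 0 := fun h => by
  have := coeff_mul_lin 1 b 1
  rw [h, mul_zero] at this
  simp [HahnSeries.coeff_one] at this

/-- Comparing coefficients in (f / lin b) · lin b = f. All information on quotients is drawn from
this recurrence. -/
theorem coeff_eq_of_div_lin (f : LaurentSeries ℂ) (b : ℂ) (i : ℤ) :
    b * (f / lin b).coeff i + (f / lin b).coeff (i - 1) / 2 = f.coeff i := by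
  rw [← coeff_mul_lin, div_mul_cancel₀ _ (lin_ne_zero b)]

theorem coeff_div_lin_zero (f : LaurentSeries ℂ) (i : ℤ) :
    (f / lin 0).coeff i = 2 * f.coeff (i + 1) := by
  rw [← coeff_eq_of_div_lin f 0 (i + 1), add_sub_cancel_right]
  ring

/-- At the order of the quotient the recurrence has a single term, so b times the leading
coefficient is a coefficient of `f`; it cannot vanish. -/
theorem coeff_div_lin_eq_zero_of_lt {f : LaurentSeries ℂ} {q : ℤ} (hf : ∀ i < q, f.coeff i = 0)
    {b : ℂ} (hb : b ≠ 0) {i : ℤ} (hi : i < q) : (f / lin b).coeff i = 0 := by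
  by_cases h0 : f / lin b = 0
  · rw [h0, HahnSeries.coeff_zero]
  · refine HahnSeries.coeff_eq_zero_of_lt_order (hi.trans_le (not_lt.1 fun hlt => ?_))
    have h1 := coeff_eq_of_div_lin f b (f / lin b).order
    rw [HahnSeries.coeff_eq_zero_of_lt_order (i := (f / lin b).order - 1) (by omega), hf _ hlt,
      zero_div, add_zero] at h1
    rcases mul_eq_zero.1 h1 with h2 | h2
    · exact hb h2
    · exact h0 (HahnSeries.coeff_order_eq_zero.1 h2)

/-- `f(s)` agrees with the Laurent series `c`, which starts at `s^{-p}` or later, up to an error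
`O(s^{l - p})`. -/
def IsExpansion (f : ℂ → ℂ) (c : LaurentSeries ℂ) (l p : ℕ) : Prop :=
  (∀ i < -(p : ℤ), c.coeff i = 0) ∧
    (fun s => s ^ p * f s - ∑ i ∈ Finset.range l, c.coeff ((i : ℤ) - p) * s ^ i)
      =O[𝓝[≠] 0] fun s => s ^ l

theorem IsExpansion.div_lin_zero {f : ℂ → ℂ} {c : LaurentSeries ℂ} {l p : ℕ}
    (h : IsExpansion f c l p) : IsExpansion (fun s => f s / (s / 2)) (c / lin 0) l (p + 1) := by
  refine ⟨fun i hi => ?_, ?_⟩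
  · rw [coeff_div_lin_zero, h.1 _ (by push_cast at hi; omega), mul_zero]
  · refine (h.2.const_mul_left 2).congr' ?_ EventuallyEq.rfl
    filter_upwards [self_mem_nhdsWithin] with s hs
    have hs : s ≠ 0 := hs
    have e : ∀ i : ℕ, (c / lin 0).coeff ((i : ℤ) - ((p + 1 : ℕ) : ℤ)) * s ^ i =
        2 * (c.coeff ((i : ℤ) - p) * s ^ i) := fun i => by
      rw [coeff_div_lin_zero]
      push_cast
      rw [show (i : ℤ) - (p + 1) + 1 = i - p by ring]
      ring
    simp only [e]
    rw [← Finset.mul_sum, mul_sub, pow_succ]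
    field_simp

/-- Multiplying the truncated quotient by s/2 + b reproduces the truncation of `c` except for one
overflow term of order s^l, which the error absorbs. -/
theorem IsExpansion.div_lin {f : ℂ → ℂ} {c : LaurentSeries ℂ} {l p : ℕ}
    (h : IsExpansion f c l p) {b : ℂ} (hb : b ≠ 0) :
    IsExpansion (fun s => f s / (s / 2 + b)) (c / lin b) l p := by
  refine ⟨fun i hi => coeff_div_lin_eq_zero_of_lt h.1 hb hi, ?_⟩
  set g := c / lin b with hg
  have hg0 : g.coeff (-1 - (p : ℤ)) = 0 := coeff_div_lin_eq_zero_of_lt h.1 hb (by omega)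
  have htend : Tendsto (fun s : ℂ => s / 2 + b) (𝓝 0) (𝓝 b) := by
    have : Continuous fun s : ℂ => s / 2 + b := by fun_prop
    simpa using this.tendsto 0
  have hinv : (fun s : ℂ => (s / 2 + b)⁻¹) =O[𝓝[≠] 0] fun _ => (1 : ℂ) :=
    ((htend.inv₀ hb).mono_left nhdsWithin_le_nhds).isBigO_one ℂ
  have h1 : (fun s : ℂ => (s ^ p * f s - ∑ i ∈ Finset.range l, c.coeff ((i : ℤ) - p) * s ^ i)
      - g.coeff ((l : ℤ) - 1 - p) / 2 * s ^ l) =O[𝓝[≠] 0] fun s => s ^ l :=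
    h.2.sub ((isBigO_refl _ _).const_mul_left _)
  have h2 := hinv.mul h1
  simp only [one_mul] at h2
  refine h2.congr' ?_ EventuallyEq.rfl
  filter_upwards [nhdsWithin_le_nhds (htend.eventually_ne hb)] with s hs
  have hsum : ∑ i ∈ Finset.range l, c.coeff ((i : ℤ) - p) * s ^ i =
      (s / 2 + b) * (∑ i ∈ Finset.range l, g.coeff ((i : ℤ) - p) * s ^ i)
        - g.coeff ((l : ℤ) - 1 - p) / 2 * s ^ l := by
    have e : ∀ i : ℕ, c.coeff ((i : ℤ) - p) * s ^ i =
        b * (g.coeff ((i : ℤ) - p) * s ^ i) + g.coeff ((i : ℤ) - 1 - p) / 2 * s ^ i := fun i => by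
      rw [← coeff_eq_of_div_lin c b ((i : ℤ) - p), ← hg,
        show (i : ℤ) - p - 1 = i - 1 - p by ring]
      ring
    have e2 := Finset.sum_range_succ' (fun i : ℕ => g.coeff ((i : ℤ) - 1 - p) / 2 * s ^ i) l
    rw [Finset.sum_range_succ] at e2
    simp only [Nat.cast_zero, zero_sub, hg0, zero_div, zero_mul, add_zero] at e2
    have e3 : ∑ i ∈ Finset.range l, g.coeff (((i + 1 : ℕ) : ℤ) - 1 - p) / 2 * s ^ (i + 1) =
        s / 2 * ∑ i ∈ Finset.range l, g.coeff ((i : ℤ) - p) * s ^ i := by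
      rw [Finset.mul_sum]
      refine Finset.sum_congr rfl fun i _ => ?_
      push_cast
      rw [add_sub_cancel_right]
      ring
    simp only [e]
    rw [Finset.sum_add_distrib, ← Finset.mul_sum]
    linear_combination e2 + e3
  rw [hsum]
  generalize ∑ i ∈ Finset.range l, g.coeff ((i : ℤ) - p) * s ^ i = A
  rw [mul_div_assoc', eq_sub_iff_add_eq, inv_mul_eq_div, eq_div_iff hs, add_mul, div_mul_cancel₀ _ hs]
  ring

theorem IsExpansion.div_prod {ι : Type*} {f : ℂ → ℂ} {c : LaurentSeries ℂ} {l p : ℕ}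
    (h : IsExpansion f c l p) (T : Finset ι) (b : ι → ℂ) :
    IsExpansion (fun s => f s / ∏ k ∈ T, (s / 2 + b k)) (c / ∏ k ∈ T, lin (b k)) l
      (p + (T.filter fun k => b k = 0).card) := by
  classical
  induction T using Finset.induction_on with
  | empty => simpa using h
  | insert k T hk ih =>
    have e1 : (fun s => f s / ∏ k ∈ insert k T, (s / 2 + b k)) =
        fun s => f s / (∏ k ∈ T, (s / 2 + b k)) / (s / 2 + b k) := by
      funext s
      rw [Finset.prod_insert hk, mul_comm, div_mul_eq_div_div]
    have e2 : c / ∏ k ∈ insert k T, lin (b k) = c / (∏ k ∈ T, lin (b k)) / lin (b k) := by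
      rw [Finset.prod_insert hk, mul_comm, div_mul_eq_div_div]
    rw [e1, e2, Finset.filter_insert]
    split_ifs with hb
    · rw [Finset.card_insert_of_notMem (by simp [hk]), ← add_assoc]
      simpa [hb] using ih.div_lin_zero
    · exact ih.div_lin hb

/-- The l known coefficients start at s^{-p}; as p ≤ l they reach past the principal part, and the
error O(s^{l-p}) is bounded. -/
theorem IsExpansion.isBigO_principalPart {f : ℂ → ℂ} {c : LaurentSeries ℂ} {l p : ℕ}
    (h : IsExpansion f c l p) (hp : p ≤ l) :
    (fun s => f s - ∑ k ∈ Finset.Icc 1 l, c.coeff (-(k : ℤ)) / s ^ k)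
      =O[𝓝[≠] 0] fun _ => (1 : ℝ) := by
  obtain ⟨q, rfl⟩ := Nat.exists_eq_add_of_le hp
  have h1 : (fun s : ℂ => (s ^ p)⁻¹ * (s ^ p * f s
      - ∑ i ∈ Finset.range (p + q), c.coeff ((i : ℤ) - p) * s ^ i)) =O[𝓝[≠] 0] fun s => s ^ q := by
    refine ((isBigO_refl (fun s : ℂ => (s ^ p)⁻¹) (𝓝[≠] 0)).mul h.2).congr' EventuallyEq.rfl ?_
    filter_upwards [self_mem_nhdsWithin] with s hs
    have hs : s ≠ 0 := hs
    rw [pow_add]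
    field_simp
  have hpow : ∀ n : ℕ, (fun s : ℂ => s ^ n) =O[𝓝[≠] 0] fun _ => (1 : ℝ) := fun n =>
    (((continuous_pow n).tendsto 0).mono_left nhdsWithin_le_nhds).isBigO_one ℝ
  have h2 : (fun s : ℂ => ∑ i ∈ Finset.range q, c.coeff (i : ℤ) * s ^ i)
      =O[𝓝[≠] 0] fun _ => (1 : ℝ) :=
    IsBigO.fun_sum fun i _ => (hpow i).const_mul_left _
  refine ((h1.trans (hpow q)).add h2).congr' ?_ EventuallyEq.rfl
  filter_upwards [self_mem_nhdsWithin] with s hs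
  have hs : s ≠ 0 := hs
  have e1 : ∑ k ∈ Finset.Icc 1 (p + q), c.coeff (-(k : ℤ)) / s ^ k =
      ∑ k ∈ Finset.range p, c.coeff (-((k + 1 : ℕ) : ℤ)) / s ^ (k + 1) := by
    rw [Finset.range_eq_Ico, Finset.sum_Ico_add' (fun k : ℕ => c.coeff (-(k : ℤ)) / s ^ k) 0 p 1,
      zero_add]
    symm
    refine Finset.sum_subset (fun k hk => ?_) fun k hk hk' => ?_
    · rw [Finset.mem_Ico] at hk
      rw [Finset.mem_Icc]
      omega
    · rw [Finset.mem_Icc] at hk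
      rw [Finset.mem_Ico] at hk'
      rw [h.1 _ (by omega), zero_div]
  have e2 : (s ^ p)⁻¹ * ∑ i ∈ Finset.range p, c.coeff ((i : ℤ) - p) * s ^ i =
      ∑ k ∈ Finset.range p, c.coeff (-((k + 1 : ℕ) : ℤ)) / s ^ (k + 1) := by
    rw [← Finset.sum_range_reflect, Finset.mul_sum]
    refine Finset.sum_congr rfl fun k hk => ?_
    have hk : k < p := Finset.mem_range.1 hk
    obtain ⟨r, rfl⟩ := Nat.exists_eq_add_of_lt hk
    have e3 : k + r + 1 - 1 - k = r := by omega
    rw [e3, show (r : ℤ) - ((k + r + 1 : ℕ) : ℤ) = -((k + 1 : ℕ) : ℤ) by push_cast; ring]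
    have : s ^ (k + r + 1) = s ^ r * s ^ (k + 1) := by ring
    rw [this]
    field_simp
  have e4 : (s ^ p)⁻¹ * ∑ i ∈ Finset.range q, c.coeff (((p + i : ℕ) : ℤ) - p) * s ^ (p + i) =
      ∑ i ∈ Finset.range q, c.coeff (i : ℤ) * s ^ i := by
    rw [Finset.mul_sum]
    refine Finset.sum_congr rfl fun i _ => ?_
    rw [pow_add]
    push_cast
    rw [add_sub_cancel_left]
    field_simp
  have e5 : (s ^ p)⁻¹ * (s ^ p * f s) = f s := by field_simp
  rw [Finset.sum_range_add, mul_sub, mul_add, e1, e2, e4, e5]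
  ring

theorem isExpansion_taylor {f : ℂ → ℂ} (hf : AnalyticAt ℂ f 0) (l : ℕ) :
    IsExpansion f (HahnSeries.ofPowerSeries ℤ ℂ (PowerSeries.mk fun i : ℕ =>
      if i < l then iteratedDeriv i f 0 / (i.factorial : ℂ) else 0)) l 0 := by
  refine ⟨fun i hi => ?_, ?_⟩
  · rw [PowerSeries.coeff_coe, if_pos (by simpa using hi)]
  · have h1 := hf.hasFPowerSeriesAt.isBigO_sub_partialSum_pow l
    simp only [FormalMultilinearSeries.partialSum, FormalMultilinearSeries.ofScalars_apply_eq,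
      zero_add, smul_eq_mul] at h1
    have h2 := h1.mono (nhdsWithin_le_nhds (s := {0}ᶜ))
    have h3 : (fun y : ℂ => ‖y‖ ^ l) =O[𝓝[≠] 0] fun y : ℂ => y ^ l :=
      IsBigO.of_norm_right (by simpa using isBigO_refl (fun y : ℂ => ‖y‖ ^ l) _)
    refine (h2.trans h3).congr' ?_ EventuallyEq.rfl
    · refine Eventually.of_forall fun s => ?_
      simp only [pow_zero, one_mul]
      congr 1
      refine Finset.sum_congr rfl fun i hi => ?_
      rw [Nat.cast_zero, sub_zero, HahnSeries.ofPowerSeries_apply_coeff, PowerSeries.coeff_mk,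
        if_pos (Finset.mem_range.1 hi)]

section

variable {d : ℕ} (lam : Fin d → ℂ)

/-- The constant term of the `k`-th factor that relates `c_j^{(n)}` to `c_j^{(n + 1)}`. -/
noncomputable def shift (j : Cls lam) (n : ℕ) (k : Fin d) : ℂ := (lam k + m lam j) / 2 - (n + 1 : ℕ)

theorem c_succ (j : Cls lam) (n : ℕ) :
    c lam j (n + 1) = c lam j n / ∏ k, lin (shift lam j n k) := by
  simp only [c, half_sub_natCast_eq_lin, shift]

theorem cls_eq_of_sub_eq {j : Cls lam} {k : Fin d} {z : ℤ}
    (h : lam k - lam (base lam j) = 2 * (z : ℂ)) : cls lam k = j := by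
  rw [← (base_spec lam j).1]
  exact Quotient.sound ⟨_, h⟩

theorem analyticAt_gammaFactor_m (j : Cls lam) : AnalyticAt ℂ (gammaFactor lam) (m lam j) := by
  have hA : ∀ k ∈ Finset.univ,
      AnalyticAt ℂ (fun s => Complex.Gamma ((s + lam k) / 2)) (m lam j) := fun k _ => by
    have hne : ∀ n : ℕ, (m lam j + lam k) / 2 ≠ -n := fun n hn => by
      -- A pole of the k-th factor at m_j would put k in the class j with a real part below the
      -- minimal one.
      have h1 : lam k - lam (base lam j) = 2 * ((-(n + 1 : ℤ) : ℤ) : ℂ) := by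
        rw [m] at hn
        push_cast
        linear_combination 2 * hn
      have h3 := (base_spec lam j).2 k (cls_eq_of_sub_eq lam h1)
      have h4 := congrArg Complex.re h1
      simp at h4
      have : (0 : ℝ) ≤ n := Nat.cast_nonneg n
      linarith
    have hG : AnalyticAt ℂ Complex.Gamma ((m lam j + lam k) / 2) := by
      have h := (Complex.differentiable_one_div_Gamma.analyticAt ((m lam j + lam k) / 2)).inv
        (inv_ne_zero (Complex.Gamma_ne_zero hne))
      simpa [Pi.inv_def] using h
    exact hG.comp_of_eq (f := fun s => (s + lam k) / 2) (by fun_prop) rfl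
  exact Finset.analyticAt_fun_prod _ hA

theorem eventually_differentiableAt_gammaFactor (z : ℂ) :
    ∀ᶠ s in 𝓝[≠] z, DifferentiableAt ℂ (gammaFactor lam) s := by
  have h : MeromorphicAt (gammaFactor lam) z := by
    have h1 : ∀ k ∈ Finset.univ,
        MeromorphicAt (fun s => Complex.Gamma ((s + lam k) / 2)) z := fun k _ =>
      (Meromorphic.Gamma ((z + lam k) / 2)).comp_analyticAt
        (g := fun s => (s + lam k) / 2) (by fun_prop)
    exact MeromorphicAt.fun_prod h1
  filter_upwards [h.eventually_analyticAt] with s hs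
  exact hs.differentiableAt

theorem size_eq_card [DecidableEq (Cls lam)] (j : Cls lam) :
    size lam j = (Finset.univ.filter fun k : Fin d => cls lam k = j).card := by
  rw [size, Nat.card_eq_fintype_card, Fintype.card_subtype]

/-- A vanishing shift puts the index k in the class j and determines i, so the sets being counted
are disjoint subsets of the class. This is why truncation before s^{l_j} loses nothing. -/
theorem sum_card_shift_le_size (j : Cls lam) (n : ℕ) :
    ∑ i ∈ Finset.range n, (Finset.univ.filter fun k => shift lam j i k = 0).card ≤ size lam j := by
  classical
  rw [size_eq_card, ← Finset.card_biUnion]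
  · refine Finset.card_le_card fun k hk => ?_
    simp only [Finset.mem_biUnion, Finset.mem_filter, Finset.mem_univ, true_and] at hk ⊢
    obtain ⟨i, -, hi⟩ := hk
    refine cls_eq_of_sub_eq lam (z := i) ?_
    rw [shift, m] at hi
    push_cast at hi ⊢
    linear_combination 2 * hi
  · intro i _ i' _ hii'
    refine Finset.disjoint_left.2 fun k hk hk' => hii' ?_
    have hk := (Finset.mem_filter.1 hk).2
    have hk' := (Finset.mem_filter.1 hk').2
    rw [shift] at hk hk'
    have : ((i + 1 : ℕ) : ℂ) = ((i' + 1 : ℕ) : ℂ) := by linear_combination hk' - hk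
    have := Nat.cast_injective this
    omega

theorem isExpansion_c (j : Cls lam) (n : ℕ) :
    IsExpansion (fun s => gammaFactor lam (s + m lam j - 2 * n)) (c lam j n) (size lam j)
      (∑ i ∈ Finset.range n, (Finset.univ.filter fun k => shift lam j i k = 0).card) := by
  induction n with
  | zero =>
    have hA : AnalyticAt ℂ (fun s : ℂ => gammaFactor lam (s + m lam j)) 0 :=
      (analyticAt_gammaFactor_m lam j).comp_of_eq (f := fun s => s + m lam j) (by fun_prop)
        (zero_add _)
    simpa [c] using isExpansion_taylor hA (size lam j)
  | succ n ih =>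
    rw [Finset.sum_range_succ, c_succ]
    have e : (fun s => gammaFactor lam (s + m lam j - 2 * ((n + 1 : ℕ) : ℂ))) = fun s =>
        gammaFactor lam (s + m lam j - 2 * n) / ∏ k, (s / 2 + shift lam j n k) := by
      funext s
      have e1 : s + m lam j - 2 * ((n + 1 : ℕ) : ℂ) = (s + m lam j - 2 * n) - 2 := by
        push_cast; ring
      rw [e1, gammaFactor_sub_two]
      congr 1
      refine Finset.prod_congr rfl fun k _ => ?_
      rw [shift]
      push_cast
      ring
    rw [e]
    exact ih.div_prod Finset.univ (shift lam j n)

theorem isBigO_gammaFactor_sub_principalPart (j : Cls lam) (n : ℕ) :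
    (fun s : ℂ => gammaFactor lam (s + m lam j - 2 * (n : ℂ))
      - ∑ k ∈ Finset.Icc 1 (size lam j), coeffC lam j n k / s ^ k) =O[𝓝[≠] 0] fun _ => (1 : ℝ) :=
  (isExpansion_c lam j n).isBigO_principalPart (sum_card_shift_le_size lam j n)

theorem coeff_c_eq_zero (j : Cls lam) (n : ℕ) {i : ℤ} (hi : i < -(size lam j : ℤ)) :
    (c lam j n).coeff i = 0 :=
  (isExpansion_c lam j n).1 i (by have := sum_card_shift_le_size lam j n; omega)

end

/-! ### Growth of the coefficients. -/

/-- The coefficients of `f`, which starts at `s^{-l}` or later, are bounded by those of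
`K s^{-l} / (1 - L s)` up to (excluding) the constant term. -/
def CoeffBound (f : LaurentSeries ℂ) (l : ℕ) (K L : ℝ) : Prop :=
  (∀ i < -(l : ℤ), f.coeff i = 0) ∧ ∀ r < l, ‖f.coeff (-(l : ℤ) + r)‖ ≤ K * L ^ r

/-- With y = 1/|b|, the series 1 / (s/2 + b) is majorized by y / (1 - y s), and the r-th coefficient
of 1 / ((1 - L s)(1 - y s)) is at most (L + y)^r. -/
theorem CoeffBound.div_lin {f : LaurentSeries ℂ} {l : ℕ} {K L : ℝ} (h : CoeffBound f l K L)
    (hK : 0 ≤ K) (hL : 0 ≤ L) {b : ℂ} (hb : b ≠ 0) :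
    CoeffBound (f / lin b) l (K * ‖b‖⁻¹) (L + ‖b‖⁻¹) := by
  have hlow : ∀ i < -(l : ℤ), (f / lin b).coeff i = 0 := fun i hi =>
    coeff_div_lin_eq_zero_of_lt h.1 hb hi
  refine ⟨hlow, fun r => ?_⟩
  have hb' : 0 < ‖b‖ := norm_pos_iff.2 hb
  set y := ‖b‖⁻¹ with hy
  have hy0 : 0 < y := inv_pos.2 hb'
  have key : ∀ i : ℤ, ‖(f / lin b).coeff i‖ ≤ y * (‖f.coeff i‖ + ‖(f / lin b).coeff (i - 1)‖) := by
    intro i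
    have h1 := coeff_eq_of_div_lin f b i
    have h2 : (f / lin b).coeff i = b⁻¹ * (f.coeff i - (f / lin b).coeff (i - 1) / 2) := by
      rw [← h1]
      field_simp
      ring
    rw [h2, norm_mul, norm_inv, ← hy]
    refine mul_le_mul_of_nonneg_left ((norm_sub_le _ _).trans ?_) hy0.le
    have : ‖(f / lin b).coeff (i - 1) / 2‖ ≤ ‖(f / lin b).coeff (i - 1)‖ := by
      rw [norm_div, Complex.norm_two]
      linarith [norm_nonneg ((f / lin b).coeff (i - 1))]
    linarith
  induction r with
  | zero =>
    intro hl
    have h1 := key (-(l : ℤ) + (0 : ℕ))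
    have h2 := h.2 0 hl
    rw [hlow (-(l : ℤ) + (0 : ℕ) - 1) (by push_cast; omega), norm_zero, add_zero] at h1
    rw [pow_zero, mul_one] at h2 ⊢
    rw [mul_comm]
    exact h1.trans (mul_le_mul_of_nonneg_left h2 hy0.le)
  | succ r ih =>
    intro hl
    have h1 := key (-(l : ℤ) + (r + 1 : ℕ))
    have h2 := h.2 (r + 1) hl
    have h3 := ih (by omega)
    rw [show -(l : ℤ) + (r + 1 : ℕ) - 1 = -(l : ℤ) + r by push_cast; ring] at h1
    have h4 : L ^ r ≤ (L + y) ^ r := pow_le_pow_left₀ hL (by linarith) r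
    calc _ ≤ y * (K * L ^ (r + 1) + K * y * (L + y) ^ r) := by
          refine h1.trans (mul_le_mul_of_nonneg_left ?_ hy0.le)
          linarith
      _ = K * y * (L ^ r * L + y * (L + y) ^ r) := by ring
      _ ≤ K * y * ((L + y) ^ r * L + y * (L + y) ^ r) := by gcongr
      _ = K * y * (L + y) ^ (r + 1) := by ring

theorem CoeffBound.div_prod {ι : Type*} {f : LaurentSeries ℂ} {l : ℕ} {K L : ℝ}
    (h : CoeffBound f l K L) (hK : 0 ≤ K) (hL : 0 ≤ L) (T : Finset ι) {b : ι → ℂ}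
    (hb : ∀ k ∈ T, b k ≠ 0) :
    CoeffBound (f / ∏ k ∈ T, lin (b k)) l (K * ∏ k ∈ T, ‖b k‖⁻¹) (L + ∑ k ∈ T, ‖b k‖⁻¹) := by
  classical
  induction T using Finset.induction_on with
  | empty => simpa using h
  | insert k T hk ih =>
    rw [Finset.prod_insert hk, Finset.prod_insert hk, Finset.sum_insert hk, mul_comm (lin (b k)),
      div_mul_eq_div_div, mul_comm ‖b k‖⁻¹, ← mul_assoc, add_comm ‖b k‖⁻¹, ← add_assoc]
    refine (ih fun i hi => hb i (Finset.mem_insert_of_mem hi)).div_lin ?_ ?_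
      (hb k (Finset.mem_insert_self _ _))
    · exact mul_nonneg hK (Finset.prod_nonneg fun _ _ => by positivity)
    · exact add_nonneg hL (Finset.sum_nonneg fun _ _ => by positivity)

/-- `∏_{N < i ≤ N + m} |a - i|⁻¹` is `O(n^{Re a} / n!)` for `n = N + m`. -/
theorem exists_prod_inv_le (a : ℂ) (N : ℕ) : ∃ C, ∀ m : ℕ, 2 ≤ m →
    ∏ i ∈ Finset.range m, ‖a - (N + i + 1 : ℕ)‖⁻¹ ≤
      C * (((N + m : ℕ) : ℝ) ^ a.re / ((N + m).factorial : ℝ)) := by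
  set s : ℂ := N + 1 - a with hs
  -- Up to the factor M^s M!, the product is Euler's sequence for Γ at s = N + 1 - a. It converges,
  -- hence is bounded; it remains to replace M by n = N + M + 1.
  obtain ⟨C, hC⟩ := (Complex.GammaSeq_tendsto_Gamma s).norm.bddAbove_range
  have hC0 : 0 ≤ C := (norm_nonneg _).trans (hC ⟨0, rfl⟩)
  set e : ℝ := N + 1 - a.re with he
  refine ⟨C * (N + 2) ^ |e|, fun m hm => ?_⟩
  obtain ⟨M, rfl⟩ : ∃ M, m = M + 1 := ⟨m - 1, by omega⟩
  have hM : 1 ≤ M := by omega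
  have hM0 : (0 : ℝ) < M := by exact_mod_cast hM
  set n := N + (M + 1) with hn
  have hn0 : (0 : ℝ) < n := by rw [hn]; positivity
  have h1 := hC ⟨M, rfl⟩
  simp only [Complex.GammaSeq, norm_div, norm_mul, norm_prod] at h1
  have h2 : ‖(M : ℂ) ^ s‖ = (M : ℝ) ^ e := by
    rw [Complex.norm_natCast_cpow_of_pos hM]
    simp [hs, he]
  have h3 : ∏ i ∈ Finset.range (M + 1), ‖a - (N + i + 1 : ℕ)‖⁻¹ =
      (∏ j ∈ Finset.range (M + 1), ‖s + j‖)⁻¹ := by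
    rw [← Finset.prod_inv_distrib]
    refine Finset.prod_congr rfl fun j _ => ?_
    rw [← norm_neg, hs]
    congr 2
    push_cast
    ring
  rw [h2, Complex.norm_natCast, div_eq_mul_inv, ← h3] at h1
  set P := ∏ i ∈ Finset.range (M + 1), ‖a - (N + i + 1 : ℕ)‖⁻¹ with hP
  have hfac : (n.factorial : ℝ) ≤ M.factorial * (n : ℝ) ^ (N + 1 : ℝ) := by
    have h4 : n.factorial ≤ M.factorial * n ^ (N + 1) := by
      have h5 := Nat.factorial_mul_descFactorial (n := n) (k := N + 1) (by omega)
      rw [show n - (N + 1) = M by omega] at h5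
      rw [← h5]
      exact Nat.mul_le_mul_left _ (Nat.descFactorial_le_pow _ _)
    have h6 : (n : ℝ) ^ (N + 1 : ℝ) = (n : ℝ) ^ (N + 1) := by
      rw [← Real.rpow_natCast]; push_cast; rfl
    rw [h6]
    exact_mod_cast h4
  have hratio : ((n : ℝ) / M) ^ e ≤ (N + 2) ^ |e| := by
    have hge : (1 : ℝ) ≤ n / M := by
      rw [one_le_div hM0]
      exact_mod_cast (by omega : M ≤ n)
    have hle : (n : ℝ) / M ≤ N + 2 := by
      rw [div_le_iff₀ hM0]
      have : n ≤ (N + 2) * M := by rw [hn]; nlinarith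
      exact_mod_cast this
    exact (Real.rpow_le_rpow_of_exponent_le hge (le_abs_self e)).trans
      (Real.rpow_le_rpow (by linarith) hle (abs_nonneg _))
  have hMe : 0 < (M : ℝ) ^ e := Real.rpow_pos_of_pos hM0 _
  have hfM : (0 : ℝ) < M.factorial := by positivity
  have hfn : (0 : ℝ) < n.factorial := by positivity
  have hna : 0 < (n : ℝ) ^ a.re := Real.rpow_pos_of_pos hn0 _
  have hP1 : P ≤ C / ((M : ℝ) ^ e * M.factorial) := by
    rw [le_div_iff₀ (by positivity), mul_comm]
    exact h1
  refine hP1.trans ?_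
  rw [mul_assoc, div_eq_mul_inv]
  refine mul_le_mul_of_nonneg_left ?_ hC0
  rw [mul_div_assoc', le_div_iff₀ hfn, inv_mul_le_iff₀ (by positivity)]
  rw [Real.div_rpow hn0.le hM0.le, div_le_iff₀ hMe] at hratio
  have hsplit : (n : ℝ) ^ (N + 1 : ℝ) = (n : ℝ) ^ e * (n : ℝ) ^ a.re := by
    rw [← Real.rpow_add hn0, he]
    ring_nf
  calc (n.factorial : ℝ) ≤ M.factorial * ((n : ℝ) ^ e * (n : ℝ) ^ a.re) := by rwa [← hsplit]
    _ ≤ M.factorial * (((N + 2) ^ |e| * (M : ℝ) ^ e) * (n : ℝ) ^ a.re) := by gcongr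
    _ = _ := by ring

section

variable {d : ℕ} (lam : Fin d → ℂ)

theorem exists_shift_norm_ge (j : Cls lam) : ∃ N : ℕ, ∀ n ≥ N, ∀ k,
    ((n + 1 : ℕ) : ℝ) / 2 ≤ ‖shift lam j n k‖ := by
  have h : ∀ k, ∃ N : ℕ, 2 * ‖(lam k + m lam j) / 2‖ ≤ N := fun k => exists_nat_ge _
  choose N hN using h
  refine ⟨∑ k, N k, fun n hn k => ?_⟩
  have h1 : N k ≤ n := (Finset.single_le_sum (fun _ _ => Nat.zero_le _) (Finset.mem_univ k)).trans hn
  have h2 : (N k : ℝ) ≤ n := by exact_mod_cast h1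
  have h3 := norm_sub_norm_le ((n + 1 : ℕ) : ℂ) ((lam k + m lam j) / 2)
  rw [Complex.norm_natCast, norm_sub_rev] at h3
  rw [shift]
  have := hN k
  push_cast at h3 ⊢
  linarith

/-- Beyond `N` no factor vanishes and each has modulus at least half its index, so one step of the
recursion adds at most 2d / (N + n + 1) to L. -/
theorem exists_coeffBound_c (j : Cls lam) : ∃ (N : ℕ) (K : ℝ), 0 ≤ K ∧ ∀ n : ℕ,
    CoeffBound (c lam j (N + n)) (size lam j)
      (K * ∏ i ∈ Finset.range n, ∏ k, ‖shift lam j (N + i) k‖⁻¹)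
      (1 + ∑ i ∈ Finset.range n, 2 * d / ((N + i + 1 : ℕ) : ℝ)) := by
  obtain ⟨N, hN⟩ := exists_shift_norm_ge lam j
  refine ⟨N, ∑ r ∈ Finset.range (size lam j), ‖(c lam j N).coeff (-(size lam j : ℤ) + r)‖,
    Finset.sum_nonneg fun _ _ => norm_nonneg _, fun n => ?_⟩
  set K := ∑ r ∈ Finset.range (size lam j), ‖(c lam j N).coeff (-(size lam j : ℤ) + r)‖ with hK
  have hK0 : 0 ≤ K := Finset.sum_nonneg fun _ _ => norm_nonneg _
  induction n with
  | zero =>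
    refine ⟨fun i hi => coeff_c_eq_zero lam j _ hi, fun r hr => ?_⟩
    simp only [Finset.range_zero, Finset.prod_empty, Finset.sum_empty, mul_one, add_zero, one_pow]
    exact Finset.single_le_sum
      (f := fun r : ℕ => ‖(c lam j N).coeff (-(size lam j : ℤ) + r)‖)
      (fun _ _ => norm_nonneg _) (Finset.mem_range.2 hr)
  | succ n ih =>
    have hge := hN (N + n) (by omega)
    have hL0 : 0 ≤ 1 + ∑ i ∈ Finset.range n, 2 * d / ((N + i + 1 : ℕ) : ℝ) :=
      add_nonneg zero_le_one (Finset.sum_nonneg fun _ _ => by positivity)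
    have hpos : ∀ k, 0 < ‖shift lam j (N + n) k‖ := fun k =>
      lt_of_lt_of_le (by positivity) (hge k)
    have hK1 : 0 ≤ K * ∏ i ∈ Finset.range n, ∏ k, ‖shift lam j (N + i) k‖⁻¹ :=
      mul_nonneg hK0 (Finset.prod_nonneg fun _ _ => Finset.prod_nonneg fun _ _ => by positivity)
    have h1 := ih.div_prod hK1 hL0 Finset.univ (b := shift lam j (N + n))
      (fun k _ => norm_pos_iff.1 (hpos k))
    rw [← c_succ] at h1
    refine ⟨h1.1, fun r hr => (h1.2 r hr).trans ?_⟩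
    rw [Finset.prod_range_succ, Finset.sum_range_succ, ← mul_assoc, ← add_assoc]
    have h2 : ∑ k, ‖shift lam j (N + n) k‖⁻¹ ≤ 2 * d / ((N + n + 1 : ℕ) : ℝ) := by
      calc _ ≤ ∑ _k : Fin d, 2 / ((N + n + 1 : ℕ) : ℝ) := Finset.sum_le_sum fun k _ => by
            rw [← inv_div]
            exact inv_anti₀ (by positivity) (hge k)
        _ = _ := by
            rw [Finset.sum_const, Finset.card_univ, Fintype.card_fin, nsmul_eq_mul]
            ring
    have h3 : 0 ≤ ∑ k, ‖shift lam j (N + n) k‖⁻¹ := Finset.sum_nonneg fun _ _ => by positivity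
    have h4 : 0 ≤ ∏ k, ‖shift lam j (N + n) k‖⁻¹ := Finset.prod_nonneg fun _ _ => by positivity
    exact mul_le_mul_of_nonneg_left
      (pow_le_pow_left₀ (add_nonneg hL0 h3) (add_le_add_right h2 _) r) (mul_nonneg hK1 h4)

theorem exists_sum_le_log (N d : ℕ) : ∃ C, ∀ n : ℕ, 1 ≤ n → 3 ≤ N + n →
    1 + ∑ i ∈ Finset.range n, 2 * d / ((N + i + 1 : ℕ) : ℝ) ≤ C * Real.log (N + n : ℕ) := by
  -- For N + n ≥ 3 > e the logarithm is at least 1, so it absorbs both the initial 1 and the 1 in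
  -- the bound for the harmonic sum.
  refine ⟨1 + 2 * d * 2, fun n hn hNn => ?_⟩
  have hlog : 1 ≤ Real.log (N + n : ℕ) := by
    rw [Real.le_log_iff_exp_le (by positivity)]
    have : (3 : ℝ) ≤ (N + n : ℕ) := by exact_mod_cast hNn
    linarith [Real.exp_one_lt_d9]
  have h1 : ∑ i ∈ Finset.range n, 2 * d / ((N + i + 1 : ℕ) : ℝ) ≤
      2 * d * (1 + Real.log (N + n : ℕ)) := by
    have h2 := harmonic_le_one_add_log (N + n)
    rw [harmonic, Rat.cast_sum] at h2
    refine le_trans ?_ (mul_le_mul_of_nonneg_left h2 (by positivity))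
    rw [Finset.sum_range_add, mul_add, Finset.mul_sum, Finset.mul_sum]
    refine le_trans (le_of_eq ?_) (le_add_of_nonneg_left (Finset.sum_nonneg fun _ _ => by positivity))
    refine Finset.sum_congr rfl fun i _ => ?_
    push_cast
    rw [div_eq_mul_inv]
  have h3 : 0 ≤ 2 * (d : ℝ) := by positivity
  nlinarith

theorem isBigO_coeffC (j : Cls lam) {k : ℕ} (hk : k ∈ Finset.Icc 1 (size lam j)) :
    (fun n : ℕ => coeffC lam j n k) =O[atTop] (fun n : ℕ => (n : ℝ) ^ growthExponent lam j
      * Real.log n ^ (size lam j - k) / (n.factorial : ℝ) ^ d) := by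
  obtain ⟨hk1, hkl⟩ := Finset.mem_Icc.1 hk
  obtain ⟨N, K, hK, hb⟩ := exists_coeffBound_c lam j
  choose C hC using fun k => exists_prod_inv_le ((lam k + m lam j) / 2) N
  obtain ⟨C', hC'⟩ := exists_sum_le_log N d
  refine IsBigO.of_bound (K * (∏ k, C k) * C' ^ (size lam j - k)) ?_
  filter_upwards [eventually_ge_atTop (N + 3)] with n hn
  obtain ⟨q, rfl⟩ := Nat.exists_eq_add_of_le (show N ≤ n by omega)
  set n := N + q with hn'
  have hn0 : (0 : ℝ) < n := by exact_mod_cast (by omega : 0 < n)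
  have hlog : 0 ≤ Real.log n := Real.log_natCast_nonneg n
  -- The coefficient of s^{-k} is number l - k from the bottom, so L, of order ln n, enters with the
  -- exponent l - k.
  have h1 := (hb q).2 (size lam j - k) (by omega)
  rw [show -(size lam j : ℤ) + (size lam j - k : ℕ) = -(k : ℤ) by omega] at h1
  rw [coeffC, Real.norm_of_nonneg (by positivity)]
  refine h1.trans ?_
  have h2 : ∏ i ∈ Finset.range q, ∏ k, ‖shift lam j (N + i) k‖⁻¹ ≤
      (∏ k, C k) * ((n : ℝ) ^ growthExponent lam j / (n.factorial : ℝ) ^ d) := by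
    rw [Finset.prod_comm]
    calc _ ≤ ∏ k, (C k * ((n : ℝ) ^ ((lam k + m lam j) / 2).re / (n.factorial : ℝ))) :=
          Finset.prod_le_prod (fun _ _ => Finset.prod_nonneg fun _ _ => by positivity)
            fun k _ => hC k q (by omega)
      _ = _ := by
          rw [Finset.prod_mul_distrib, Finset.prod_div_distrib, Finset.prod_const,
            Finset.card_univ, Fintype.card_fin, ← Real.rpow_sum_of_pos hn0, growthExponent,
            Finset.sum_div]
          congr 4
          funext k
          simp
  have h3 := hC' q (by omega) (by omega)
  have h4 : 0 ≤ 1 + ∑ i ∈ Finset.range q, 2 * d / ((N + i + 1 : ℕ) : ℝ) :=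
    add_nonneg zero_le_one (Finset.sum_nonneg fun _ _ => by positivity)
  have h5 : 0 ≤ (∏ k, C k) * ((n : ℝ) ^ growthExponent lam j / (n.factorial : ℝ) ^ d) :=
    le_trans (Finset.prod_nonneg fun _ _ => Finset.prod_nonneg fun _ _ => by positivity) h2
  calc _ ≤ K * ((∏ k, C k) * ((n : ℝ) ^ growthExponent lam j / (n.factorial : ℝ) ^ d)) *
        (C' * Real.log n) ^ (size lam j - k) :=
        mul_le_mul (mul_le_mul_of_nonneg_left h2 hK) (pow_le_pow_left₀ h4 h3 _)
          (pow_nonneg h4 _) (mul_nonneg hK h5)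
    _ = _ := by rw [mul_pow]; ring

theorem summable_rpow_mul_log_pow_mul_pow_div_factorial (hd : 1 ≤ d) (B : ℝ) (q : ℕ) (t : ℝ) :
    Summable fun n : ℕ => (n : ℝ) ^ B * Real.log n ^ q / (n.factorial : ℝ) ^ d * t ^ (2 * n) := by
  obtain ⟨P, hP⟩ := exists_nat_ge B
  -- The factor 2^n in the comparison series absorbs all powers of n and ln n; of (n!)^d only n! is
  -- used.
  refine summable_of_isBigO_nat (Real.summable_pow_div_factorial (2 * t ^ 2)) ?_
  have h1 : (fun n : ℕ => (n : ℝ) ^ B * Real.log n ^ q / (n.factorial : ℝ) ^ d * t ^ (2 * n))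
      =O[atTop] fun n : ℕ => (n : ℝ) ^ (P + q) * ((t ^ 2) ^ n / n.factorial) := by
    refine IsBigO.of_bound 1 ?_
    filter_upwards [eventually_ge_atTop 1] with n hn
    have hn1 : (1 : ℝ) ≤ n := by exact_mod_cast hn
    have hlog : 0 ≤ Real.log n := Real.log_natCast_nonneg n
    have ht : 0 ≤ t ^ (2 * n) := by rw [pow_mul]; positivity
    rw [one_mul, Real.norm_of_nonneg (by positivity), Real.norm_of_nonneg (by positivity)]
    have h2 : (n : ℝ) ^ B ≤ (n : ℝ) ^ P := by
      rw [← Real.rpow_natCast]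
      exact Real.rpow_le_rpow_of_exponent_le hn1 hP
    have h3 : Real.log n ≤ n := (Real.log_le_sub_one_of_pos (by linarith)).trans (by linarith)
    have h4 : (n.factorial : ℝ) ≤ (n.factorial : ℝ) ^ d :=
      le_self_pow₀ (by exact_mod_cast n.factorial_pos) (by omega)
    calc _ ≤ (n : ℝ) ^ P * (n : ℝ) ^ q / (n.factorial : ℝ) * t ^ (2 * n) := by gcongr
      _ = _ := by rw [pow_mul, pow_add]; ring
  refine h1.trans ?_
  have h2 := (isLittleO_pow_const_const_pow_of_one_lt (R := ℝ) (P + q) one_lt_two).isBigO.mul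
    (isBigO_refl (fun n : ℕ => (t ^ 2) ^ n / (n.factorial : ℝ)) atTop)
  refine h2.congr' EventuallyEq.rfl (Eventually.of_forall fun n => ?_)
  simp only [mul_pow]
  ring

theorem summable_logPoly (hd : 1 ≤ d) (j : Cls lam) (t : ℝ) :
    Summable fun n : ℕ+ => logPoly lam j n t * (t : ℂ) ^ (2 * (n : ℕ)) := by
  have h : Summable fun n : ℕ => logPoly lam j n t * (t : ℂ) ^ (2 * n) := by
    simp only [logPoly, Finset.sum_mul]
    refine summable_sum fun k hk => ?_
    have h1 := isBigO_coeffC lam j (k := k + 1)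
      (Finset.mem_Icc.2 ⟨by omega, Finset.mem_range.1 hk⟩)
    have h2 : Summable fun n : ℕ => coeffC lam j n (k + 1) * (t : ℂ) ^ (2 * n) := by
      refine summable_of_isBigO_nat (summable_rpow_mul_log_pow_mul_pow_div_factorial hd
        (growthExponent lam j) (size lam j - (k + 1)) t) (h1.mul ?_)
      refine IsBigO.of_bound 1 (Eventually.of_forall fun n => ?_)
      rw [one_mul, norm_pow, norm_pow, Complex.norm_real]
    refine (h2.mul_left ((-(Real.log t : ℂ)) ^ k / (k.factorial : ℂ))).congr fun n => ?_
    ring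
  exact h.comp_injective PNat.coe_injective

end

/-! ### Poles and residues of γ(s) t^{-s}. -/

/-- Multiplication of a principal part by an exponential. -/
theorem HasPrincipalPart.mul_exp {f : ℂ → ℂ} {z : ℂ} {l : ℕ} {a : ℕ → ℂ}
    (h : HasPrincipalPart f z l a) (ha : ∀ k, l < k → a k = 0) (w : ℂ) {g : ℂ → ℂ} (A : ℂ)
    (hg : ∀ s, g (s + z) = f (s + z) * (A * Complex.exp (w * s))) :
    HasPrincipalPart g z l fun i =>
      A * ∑ q ∈ Finset.range l, w ^ q / (q.factorial : ℂ) * a (q + i) := by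
  have hexp : (fun s : ℂ => A * Complex.exp (w * s)) =O[𝓝[≠] 0] fun _ => (1 : ℝ) := by
    have : Continuous fun s : ℂ => A * Complex.exp (w * s) := by fun_prop
    exact ((this.tendsto 0).mono_left nhdsWithin_le_nhds).isBigO_one ℝ
  have h1 := h.mul hexp
  simp only [mul_one] at h1
  -- In the term with s^{-k}, the exponential may be replaced by its Taylor polynomial of degree
  -- below k, at a bounded cost.
  have h2 : ∀ k, (fun s : ℂ => A * a k * ((s ^ k)⁻¹ * (Complex.exp (w * s) -
      ∑ q ∈ Finset.range k, (w * s) ^ q / (q.factorial : ℂ)))) =O[𝓝[≠] 0] fun _ => (1 : ℝ) := by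
    intro k
    have ht : Tendsto (fun s : ℂ => w * s) (𝓝[≠] 0) (𝓝 0) := by
      have : Continuous fun s : ℂ => w * s := by fun_prop
      simpa using (this.tendsto 0).mono_left (nhdsWithin_le_nhds (s := {0}ᶜ))
    have h3 := (Complex.exp_sub_sum_range_isBigO_pow k).comp_tendsto ht
    have h4 : (fun s : ℂ => (w * s) ^ k) =O[𝓝[≠] 0] fun s : ℂ => s ^ k := by
      simp only [mul_pow]
      exact (isBigO_refl _ _).const_mul_left _
    have h5 := (isBigO_refl (fun s : ℂ => (s ^ k)⁻¹) (𝓝[≠] 0)).mul (h3.trans h4)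
    refine (h5.trans ?_).const_mul_left _
    refine IsBigO.of_bound 1 ?_
    filter_upwards [self_mem_nhdsWithin] with s hs
    have hs : s ≠ 0 := hs
    rw [inv_mul_cancel₀ (pow_ne_zero _ hs)]
    simp
  refine (h1.add (IsBigO.fun_sum fun k (_ : k ∈ Finset.Icc 1 l) => h2 k)).congr' ?_ EventuallyEq.rfl
  filter_upwards [self_mem_nhdsWithin] with s hs
  have hs : s ≠ 0 := hs
  have e1 : ∀ q ∈ Finset.range l, ∑ i ∈ Finset.Icc 1 l, a (q + i) / s ^ i =
      ∑ k ∈ Finset.Icc 1 l, if q < k then a k * (s ^ q / s ^ k) else 0 := fun q hq => by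
    rw [← Finset.sum_filter]
    have e2 : ∑ i ∈ Finset.Icc 1 l, a (q + i) / s ^ i =
        ∑ k ∈ (Finset.Icc 1 l).map (addLeftEmbedding q), a k * (s ^ q / s ^ k) := by
      rw [Finset.sum_map]
      refine Finset.sum_congr rfl fun i _ => ?_
      rw [addLeftEmbedding_apply, pow_add]
      field_simp
    rw [e2]
    symm
    refine Finset.sum_subset (fun k hk => ?_) fun k hk hk' => ?_
    · rw [Finset.mem_filter, Finset.mem_Icc] at hk
      rw [Finset.mem_map]
      exact ⟨k - q, Finset.mem_Icc.2 (by omega), by simp; omega⟩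
    · rw [Finset.mem_map] at hk
      obtain ⟨i, hi, rfl⟩ := hk
      rw [Finset.mem_Icc] at hi
      rw [Finset.mem_filter, Finset.mem_Icc] at hk'
      simp only [addLeftEmbedding_apply] at hk' ⊢
      rw [ha _ (by omega), zero_mul]
  have e3 : ∑ i ∈ Finset.Icc 1 l,
      (A * ∑ q ∈ Finset.range l, w ^ q / (q.factorial : ℂ) * a (q + i)) / s ^ i =
      A * ∑ k ∈ Finset.Icc 1 l, a k *
        ((s ^ k)⁻¹ * ∑ q ∈ Finset.range k, (w * s) ^ q / (q.factorial : ℂ)) := by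
    have e4 : ∑ i ∈ Finset.Icc 1 l,
        (A * ∑ q ∈ Finset.range l, w ^ q / (q.factorial : ℂ) * a (q + i)) / s ^ i =
        A * ∑ q ∈ Finset.range l, w ^ q / (q.factorial : ℂ) *
          ∑ i ∈ Finset.Icc 1 l, a (q + i) / s ^ i := by
      simp only [Finset.mul_sum, Finset.sum_div]
      rw [Finset.sum_comm]
      refine Finset.sum_congr rfl fun q _ => Finset.sum_congr rfl fun i _ => ?_
      ring
    rw [e4, Finset.sum_congr rfl fun q hq => by rw [e1 q hq]]
    congr 1
    simp only [Finset.mul_sum]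
    rw [Finset.sum_comm]
    refine Finset.sum_congr rfl fun k hk => ?_
    have hkl := (Finset.mem_Icc.1 hk).2
    simp only [mul_ite, mul_zero]
    rw [← Finset.sum_filter]
    have e5 : (Finset.range l).filter (fun q => q < k) = Finset.range k := by
      ext q
      simp only [Finset.mem_filter, Finset.mem_range]
      omega
    rw [e5]
    refine Finset.sum_congr rfl fun q _ => ?_
    rw [mul_pow]
    ring
  rw [e3, hg, sub_mul, Finset.sum_mul, Finset.mul_sum]
  have e6 : ∀ k ∈ Finset.Icc 1 l, A * a k * ((s ^ k)⁻¹ * (Complex.exp (w * s) -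
      ∑ q ∈ Finset.range k, (w * s) ^ q / (q.factorial : ℂ))) =
      a k / s ^ k * (A * Complex.exp (w * s)) - A * (a k *
        ((s ^ k)⁻¹ * ∑ q ∈ Finset.range k, (w * s) ^ q / (q.factorial : ℂ))) := fun k _ => by
    ring
  rw [Finset.sum_congr rfl e6, Finset.sum_sub_distrib]
  ring

section

variable {d : ℕ} (lam : Fin d → ℂ)

/-- The `n`-th pole of `γ` that belongs to the class `j`. -/
noncomputable def pole (x : Cls lam × ℕ+) : ℂ := m lam x.1 - 2 * ((x.2 : ℕ) : ℂ)

theorem pole_injective : Function.Injective (pole lam) := by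
  rintro ⟨j, n⟩ ⟨j', n'⟩ h
  simp only [pole, m] at h
  have hj : j = j' := by
    rw [← (base_spec lam j).1]
    refine cls_eq_of_sub_eq lam (z := ((n' : ℕ) : ℤ) - ((n : ℕ) : ℤ)) ?_
    push_cast
    linear_combination -h
  subst hj
  have h1 : ((n : ℕ) : ℂ) = ((n' : ℕ) : ℂ) := by linear_combination -h / 2
  rw [Prod.mk.injEq]
  exact ⟨rfl, PNat.coe_injective (Nat.cast_injective h1)⟩

theorem pole_re (x : Cls lam × ℕ+) :
    (pole lam x).re = -(lam (base lam x.1)).re + 2 - 2 * ((x.2 : ℕ) : ℝ) := by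
  simp [pole, m]

theorem pole_re_le (x : Cls lam × ℕ+) : (pole lam x).re ≤ -(lam (base lam x.1)).re := by
  have : (1 : ℝ) ≤ ((x.2 : ℕ) : ℝ) := by exact_mod_cast x.2.pos
  rw [pole_re]
  linarith

theorem mem_range_pole (k : Fin d) (n : ℕ) : -lam k - 2 * (n : ℂ) ∈ Set.range (pole lam) := by
  obtain ⟨h1, h2⟩ := base_spec lam (cls lam k)
  obtain ⟨z, hz⟩ : ∃ z : ℤ, lam k - lam (base lam (cls lam k)) = 2 * (z : ℂ) :=
    Quotient.exact h1.symm
  have h3 := h2 k rfl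
  have h4 := congrArg Complex.re hz
  have hz0 : 0 ≤ z := by
    simp at h4
    have : (0 : ℝ) ≤ z := by linarith
    exact_mod_cast this
  lift z to ℕ using hz0
  -- Here λₖ = λ_base + 2z with z ≥ 0 by minimality; the additional 1 arises because m_j - 2 =
  -- -λ_base is the first pole of its class.
  refine ⟨(cls lam k, ⟨z + n + 1, by omega⟩), ?_⟩
  simp only [pole, m, PNat.mk_coe]
  push_cast at hz ⊢
  linear_combination hz

theorem differentiableAt_gammaFactor_of_notMem {s : ℂ} (hs : s ∉ Set.range (pole lam)) :
    DifferentiableAt ℂ (gammaFactor lam) s :=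
  differentiableAt_gammaFactor lam fun k n h => hs (h ▸ mem_range_pole lam k n)

theorem one_le_size (j : Cls lam) : 1 ≤ size lam j := by
  classical
  rw [size_eq_card, Nat.one_le_iff_ne_zero, Finset.card_ne_zero]
  exact ⟨base lam j, by simp [(base_spec lam j).1]⟩

/-- The coefficients of the principal part of `γ(s) t^{-s}` at a pole. -/
noncomputable def polarCoeff (t : ℝ) (x : Cls lam × ℕ+) (i : ℕ) : ℂ :=
  (t : ℂ) ^ (-pole lam x) * ∑ q ∈ Finset.range (size lam x.1),
    (-(Real.log t : ℂ)) ^ q / (q.factorial : ℂ) * coeffC lam x.1 x.2 (q + i)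

theorem polarCoeff_one (t : ℝ) (x : Cls lam × ℕ+) :
    polarCoeff lam t x 1 = (t : ℂ) ^ (-pole lam x) * logPoly lam x.1 x.2 t := rfl

theorem hasPrincipalPart_mellinIntegrand {t : ℝ} (ht : 0 < t) (x : Cls lam × ℕ+) :
    HasPrincipalPart (mellinIntegrand lam t) (pole lam x) (size lam x.1) (polarCoeff lam t x) := by
  have h : HasPrincipalPart (gammaFactor lam) (pole lam x) (size lam x.1)
      (coeffC lam x.1 x.2) := by
    have := isBigO_gammaFactor_sub_principalPart lam x.1 x.2
    simpa only [HasPrincipalPart, pole, add_sub_assoc] using this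
  refine h.mul_exp (fun k hk => coeff_c_eq_zero lam _ _ (by omega)) (-(Real.log t : ℂ)) _
    fun s => ?_
  have ht0 : (t : ℂ) ≠ 0 := by exact_mod_cast ht.ne'
  rw [mellinIntegrand, neg_add_rev, Complex.cpow_add _ _ ht0, Complex.cpow_def_of_ne_zero ht0 (-s),
    ← Complex.ofReal_log ht.le]
  ring_nf

theorem eventually_differentiableAt_mellinIntegrand {t : ℝ} (ht : 0 < t) (z : ℂ) :
    ∀ᶠ s in 𝓝[≠] z, DifferentiableAt ℂ (mellinIntegrand lam t) s := by
  filter_upwards [eventually_differentiableAt_gammaFactor lam z] with s hs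
  exact hs.mul (differentiableAt_cpow_neg ht s)

theorem residue_mellinIntegrand_pole {t : ℝ} (ht : 0 < t) (x : Cls lam × ℕ+) :
    residue (mellinIntegrand lam t) (pole lam x) =
      (t : ℂ) ^ (-pole lam x) * logPoly lam x.1 x.2 t :=
  (hasPrincipalPart_mellinIntegrand lam ht x).residue_eq (one_le_size lam x.1)
    (eventually_differentiableAt_mellinIntegrand lam ht _)

theorem residue_mellinIntegrand_of_notMem {t : ℝ} (ht : 0 < t) {z : ℂ}
    (hz : z ∉ Set.range (pole lam)) : residue (mellinIntegrand lam t) z = 0 := by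
  have hd : DifferentiableAt ℂ (mellinIntegrand lam t) z :=
    (differentiableAt_gammaFactor_of_notMem lam hz).mul (differentiableAt_cpow_neg ht z)
  have h : HasPrincipalPart (mellinIntegrand lam t) z 1 fun _ => 0 := by
    have h1 : ContinuousAt (fun s => mellinIntegrand lam t (s + z)) 0 :=
      ContinuousAt.comp_of_eq hd.continuousAt (by fun_prop) (zero_add z)
    simpa [HasPrincipalPart] using
      (h1.tendsto.mono_left (nhdsWithin_le_nhds (s := {0}ᶜ))).isBigO_one ℝ
  exact h.residue_eq le_rfl (eventually_differentiableAt_mellinIntegrand lam ht z)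

theorem cpow_neg_pole {t : ℝ} (ht : 0 < t) (x : Cls lam × ℕ+) :
    (t : ℂ) ^ (-pole lam x) = (t : ℂ) ^ (-m lam x.1) * (t : ℂ) ^ (2 * (x.2 : ℕ)) := by
  have ht0 : (t : ℂ) ≠ 0 := by exact_mod_cast ht.ne'
  rw [← Complex.cpow_natCast, ← Complex.cpow_add _ _ ht0, pole]
  congr 1
  push_cast
  ring

theorem summable_residues (hd : 1 ≤ d) {t : ℝ} (ht : 0 < t) :
    Summable fun x : Cls lam × ℕ+ => (t : ℂ) ^ (-pole lam x) * logPoly lam x.1 x.2 t := by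
  refine Summable.of_norm ((summable_prod_of_nonneg fun x => norm_nonneg _).2
    ⟨fun j => ?_, (hasSum_fintype _).summable⟩)
  refine (((summable_logPoly lam hd j t).mul_left ((t : ℂ) ^ (-m lam j))).congr fun n => ?_).norm
  rw [cpow_neg_pole lam ht]
  ring

theorem finite_pole_re_gt (σ : ℝ) : {x : Cls lam × ℕ+ | σ < (pole lam x).re}.Finite := by
  obtain ⟨B, hB⟩ := exists_nat_ge (∑ k, |(lam k).re| + 2 + |σ|)
  refine (Set.finite_univ.prod (Set.finite_Iic B.succPNat)).subset fun x hx => ?_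
  refine ⟨trivial, ?_⟩
  have hx : σ < (pole lam x).re := hx
  rw [pole_re] at hx
  have h1 : |(lam (base lam x.1)).re| ≤ ∑ k, |(lam k).re| :=
    Finset.single_le_sum (f := fun k => |(lam k).re|) (fun _ _ => abs_nonneg _) (Finset.mem_univ _)
  have h2 : ((x.2 : ℕ) : ℝ) ≤ B := by
    linarith [neg_abs_le (lam (base lam x.1)).re, neg_abs_le σ, abs_nonneg σ,
      abs_nonneg (lam (base lam x.1)).re, (Nat.cast_nonneg (x.2 : ℕ) : (0 : ℝ) ≤ ((x.2 : ℕ) : ℝ))]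
  have h3 : (x.2 : ℕ) ≤ B + 1 := by
    have : (x.2 : ℕ) ≤ B := by exact_mod_cast h2
    omega
  exact h3

/-- The poles to the right of the line `Re s = σ`. -/
noncomputable def polesRight (σ : ℝ) : Finset (Cls lam × ℕ+) := (finite_pole_re_gt lam σ).toFinset

theorem mem_polesRight {σ : ℝ} {x : Cls lam × ℕ+} :
    x ∈ polesRight lam σ ↔ σ < (pole lam x).re := by
  simp [polesRight]

theorem mellinInv_sub_mellinInv (hd : 1 ≤ d) {σ₁ σ₂ : ℝ} (h₁ : ∀ k, 0 < σ₁ + (lam k).re)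
    (h₂ : ∀ x, (pole lam x).re ≠ σ₂) (h : σ₂ ≤ σ₁) {t : ℝ} (ht : 0 < t) :
    mellinInv σ₁ (gammaFactor lam) t - mellinInv σ₂ (gammaFactor lam) t =
      ∑ x ∈ polesRight lam σ₂, (t : ℂ) ^ (-pole lam x) * logPoly lam x.1 x.2 t := by
  classical
  obtain ⟨C, Y, hC⟩ := exists_mellinIntegrand_decay lam hd ht σ₂ σ₁
  have hinj := pole_injective lam
  have key := integral_vertical_sub (F := mellinIntegrand lam t) h
    ((polesRight lam σ₂).image (pole lam))
    (fun z hz => by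
      obtain ⟨x, hx, rfl⟩ := Finset.mem_image.1 hz
      exact ⟨(mem_polesRight lam).1 hx, (pole_re_le lam x).trans_lt (by linarith [h₁ (base lam x.1)])⟩)
    (fun s hs hsS => by
      refine (differentiableAt_gammaFactor_of_notMem lam ?_).mul (differentiableAt_cpow_neg ht s)
      rintro ⟨x, rfl⟩
      exact hsS (Finset.mem_image_of_mem _
        ((mem_polesRight lam).2 (lt_of_le_of_ne hs.1 (h₂ x).symm))))
    hC
    -- The residue theorem is indexed by complex numbers, so data given on pairs (class, n) are
    -- carried over along the injective `pole`; the default values are never used.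
    (Function.extend (pole lam) (fun x => size lam x.1) fun _ => 1)
    (fun z hz => by
      obtain ⟨x, hx, rfl⟩ := Finset.mem_image.1 hz
      rw [hinj.extend_apply]
      exact one_le_size lam x.1)
    (Function.extend (pole lam) (fun x => polarCoeff lam t x) fun _ _ => 0)
    (fun z hz => by
      obtain ⟨x, hx, rfl⟩ := Finset.mem_image.1 hz
      rw [hinj.extend_apply, hinj.extend_apply]
      exact hasPrincipalPart_mellinIntegrand lam ht x)
  rw [mellinInv_gammaFactor, mellinInv_gammaFactor, ← mul_sub, key,
    Finset.sum_image hinj.injOn]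
  have hpi : (π : ℂ) ≠ 0 := by exact_mod_cast Real.pi_ne_zero
  rw [inv_mul_cancel_left₀ (by simp [hpi])]
  refine Finset.sum_congr rfl fun x _ => ?_
  rw [hinj.extend_apply, polarCoeff_one]

/-! ### Shifting the line to the left and summing the residues. -/

/-- The factor by which `γ` shrinks on moving `2n` to the left. -/
noncomputable def shrink (σ : ℝ) (n : ℕ) : ℝ :=
  ∏ i ∈ Finset.range n, ∏ k, |(σ + (lam k).re) / 2 - (i + 1 : ℕ)|⁻¹

/-- Each factor produced by the functional equation is bounded below by its real part, which does
not depend on y and is nonzero for generic σ. -/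
theorem norm_gammaFactor_sub_le {σ : ℝ} (hσ : ∀ k, ∀ z : ℤ, σ + (lam k).re ≠ 2 * z) (n : ℕ)
    (y : ℝ) : ‖gammaFactor lam ((σ - 2 * n : ℝ) + y * Complex.I)‖ ≤
      ‖gammaFactor lam (σ + y * Complex.I)‖ * shrink lam σ n := by
  induction n with
  | zero => simp [shrink]
  | succ n ih =>
    have e : (((σ - 2 * (n + 1 : ℕ) : ℝ)) : ℂ) + y * Complex.I =
        ((σ - 2 * n : ℝ) + y * Complex.I) - 2 := by
      push_cast; ring
    rw [e, gammaFactor_sub_two, norm_div, shrink, Finset.prod_range_succ, ← mul_assoc,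
      div_eq_mul_inv, norm_prod, ← Finset.prod_inv_distrib]
    refine mul_le_mul ih ?_ (Finset.prod_nonneg fun _ _ => by positivity) ?_
    · refine Finset.prod_le_prod (fun _ _ => by positivity) fun k _ => ?_
      have hne : (σ + (lam k).re) / 2 - (n + 1 : ℕ) ≠ 0 := fun h => hσ k (n + 1 : ℕ) (by
        push_cast at h ⊢
        linarith)
      refine inv_anti₀ (abs_pos.2 hne) ?_
      refine le_trans (le_of_eq ?_) (Complex.abs_re_le_norm _)
      congr 1
      simp
      ring
    · exact mul_nonneg (norm_nonneg _)
        (Finset.prod_nonneg fun _ _ => Finset.prod_nonneg fun _ _ => by positivity)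

/-- Ratio test: consecutive terms have quotient t² ∏ₖ |(σ + Re λₖ)/2 - (n + 1)|⁻¹, which tends to 0
as d ≥ 1. -/
theorem tendsto_shrink_mul_pow (hd : 1 ≤ d) {σ : ℝ}
    (hσ : ∀ k, ∀ z : ℤ, σ + (lam k).re ≠ 2 * z) {t : ℝ} (ht : 0 < t) :
    Tendsto (fun n : ℕ => shrink lam σ n * t ^ (2 * n)) atTop (𝓝 0) := by
  have hpos : ∀ n : ℕ, 0 < shrink lam σ n := fun n =>
    Finset.prod_pos fun i _ => Finset.prod_pos fun k _ => inv_pos.2 (abs_pos.2 fun h =>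
      hσ k (i + 1 : ℕ) (by push_cast at h ⊢; linarith))
  refine (summable_of_ratio_test_tendsto_lt_one (l := 0) zero_lt_one
    (Eventually.of_forall fun n => (mul_pos (hpos n) (pow_pos ht _)).ne') ?_).tendsto_atTop_zero
  have h1 : ∀ n : ℕ, ‖shrink lam σ (n + 1) * t ^ (2 * (n + 1))‖ / ‖shrink lam σ n * t ^ (2 * n)‖ =
      t ^ 2 * ∏ k, |(σ + (lam k).re) / 2 - (n + 1 : ℕ)|⁻¹ := fun n => by
    rw [Real.norm_of_nonneg (mul_pos (hpos _) (pow_pos ht _)).le,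
      Real.norm_of_nonneg (mul_pos (hpos _) (pow_pos ht _)).le,
      div_eq_iff (mul_pos (hpos n) (pow_pos ht _)).ne', shrink, Finset.prod_range_succ, ← shrink]
    ring
  simp only [h1]
  have h2 : Tendsto (fun n : ℕ => t ^ 2 * ∏ k, |(σ + (lam k).re) / 2 - (n + 1 : ℕ)|⁻¹) atTop
      (𝓝 (t ^ 2 * ∏ _k : Fin d, 0)) := by
    refine Tendsto.const_mul _ (tendsto_finsetProd _ fun k _ => ?_)
    refine tendsto_inv_atTop_zero.comp (tendsto_abs_atBot_atTop.comp ?_)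
    refine tendsto_atBot_add_const_left _ _ (tendsto_neg_atTop_atBot.comp ?_)
    exact tendsto_natCast_atTop_atTop.comp (tendsto_add_atTop_nat 1)
  rwa [Finset.prod_const, Finset.card_univ, Fintype.card_fin, zero_pow (by omega), mul_zero] at h2

theorem tendsto_mellinInv_left (hd : 1 ≤ d) {σ : ℝ}
    (hσ : ∀ k, ∀ z : ℤ, σ + (lam k).re ≠ 2 * z) {t : ℝ} (ht : 0 < t) :
    Tendsto (fun n : ℕ => mellinInv (σ - 2 * n) (gammaFactor lam) t) atTop (𝓝 0) := by
  have hint : ∀ n : ℕ, Integrable fun y : ℝ =>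
      gammaFactor lam ((σ - 2 * n : ℝ) + y * Complex.I) := fun n =>
    verticalIntegrable_gammaFactor lam hd fun k i h => hσ k (n - i) (by
      push_cast
      linarith)
  set I := ∫ y : ℝ, ‖gammaFactor lam (σ + y * Complex.I)‖ with hI
  have hb : ∀ n : ℕ, ‖mellinInv (σ - 2 * n) (gammaFactor lam) t‖ ≤
      (2 * π)⁻¹ * I * t ^ (-σ) * (shrink lam σ n * t ^ (2 * n)) := fun n => by
    refine (norm_mellinInv_gammaFactor_le lam _ ht).trans ?_
    have h1 : ∫ y : ℝ, ‖gammaFactor lam ((σ - 2 * n : ℝ) + y * Complex.I)‖ ≤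
        I * shrink lam σ n := by
      rw [hI, ← integral_mul_const]
      refine integral_mono (hint n).norm (Integrable.mul_const ?_ _)
        fun y => norm_gammaFactor_sub_le lam hσ n y
      simpa using (hint 0).norm
    have h2 : t ^ (-(σ - 2 * n)) = t ^ (-σ) * t ^ (2 * n) := by
      rw [← Real.rpow_natCast, ← Real.rpow_add ht]
      congr 1
      push_cast
      ring
    rw [h2]
    have hpi := Real.pi_pos
    calc _ ≤ (2 * π)⁻¹ * (I * shrink lam σ n) * (t ^ (-σ) * t ^ (2 * n)) := by gcongr
      _ = _ := by ring
  have h3 := (tendsto_shrink_mul_pow lam hd hσ ht).const_mul ((2 * π)⁻¹ * I * t ^ (-σ))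
  rw [mul_zero] at h3
  exact squeeze_zero_norm hb h3

/-- Only countably many abscissas are excluded. For the others, none of the shifted lines meets a
pole. -/
theorem exists_generic_abscissa (σ : ℝ) :
    ∃ σ' : ℝ, σ < σ' ∧ ∀ k, ∀ z : ℤ, σ' + (lam k).re ≠ 2 * z := by
  have hc : (Set.range fun x : Fin d × ℤ => 2 * (x.2 : ℝ) - (lam x.1).re).Countable :=
    Set.countable_range _
  obtain ⟨σ', h1, h2⟩ := (hc.dense_compl ℝ).exists_gt σ
  exact ⟨σ', h2, fun k z h => h1 ⟨(k, z), by simp only; linarith⟩⟩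

/-- Summability is already known, so the sum can be found along the finite sets `polesRight` at σ' -
2n, which exhaust all poles. -/
theorem hasSum_residues (hd : 1 ≤ d) {σ : ℝ} (hσ : ∀ k, 0 < σ + (lam k).re) {t : ℝ} (ht : 0 < t) :
    HasSum (fun x : Cls lam × ℕ+ => (t : ℂ) ^ (-pole lam x) * logPoly lam x.1 x.2 t)
      (mellinInv σ (gammaFactor lam) t) := by
  obtain ⟨σ', hσσ', hgen⟩ := exists_generic_abscissa lam σ
  have hσ' : ∀ k, 0 < σ' + (lam k).re := fun k => by linarith [hσ k]
  rw [mellinInv_gammaFactor_eq lam hd hσ hσ' ht]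
  have hs := (summable_residues lam hd ht).hasSum
  have hT : Tendsto (fun n : ℕ => polesRight lam (σ' - 2 * n)) atTop atTop := by
    refine tendsto_atTop_finset_of_monotone (fun a b hab x hx => ?_) fun x => ?_
    · rw [mem_polesRight] at hx ⊢
      have : (a : ℝ) ≤ b := by exact_mod_cast hab
      linarith
    · obtain ⟨n, hn⟩ := exists_nat_gt ((σ' - (pole lam x).re) / 2)
      exact ⟨n, (mem_polesRight lam).2 (by linarith)⟩
  have h1 := hs.comp hT
  have h2 : Tendsto (fun n : ℕ => mellinInv σ' (gammaFactor lam) t -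
      mellinInv (σ' - 2 * n) (gammaFactor lam) t) atTop
      (𝓝 (mellinInv σ' (gammaFactor lam) t - 0)) :=
    tendsto_const_nhds.sub (tendsto_mellinInv_left lam hd hgen ht)
  have h3 : (fun n : ℕ => mellinInv σ' (gammaFactor lam) t -
      mellinInv (σ' - 2 * n) (gammaFactor lam) t) = (fun T => ∑ x ∈ T,
        (t : ℂ) ^ (-pole lam x) * logPoly lam x.1 x.2 t) ∘
          fun n : ℕ => polesRight lam (σ' - 2 * n) := by
    funext n
    refine mellinInv_sub_mellinInv lam hd hσ' (fun x h => ?_) (by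
      linarith [(Nat.cast_nonneg n : (0 : ℝ) ≤ n)]) ht
    rw [pole_re] at h
    refine hgen (base lam x.1) (1 - ((x.2 : ℕ) : ℤ) + n) ?_
    push_cast
    linarith
  rw [h3, sub_zero] at h2
  rwa [tendsto_nhds_unique h1 h2] at hs

end

end GammaFactor

theorem mainTheorem2 (d : ℕ) (hd : 1 ≤ d) (lam : Fin d → ℂ)
    (σ : ℝ) (hσ : ∀ k, 0 < σ + (lam k).re)
    (φ : ℝ → ℂ) (hφ : φ = mellinInv σ (GammaFactor.gammaFactor lam)) :
    -- the integral that defines `φ` converges absolutely, and `γ` is the Mellin transform of `φ`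
    Complex.VerticalIntegrable (GammaFactor.gammaFactor lam) σ ∧
    (∀ s : ℂ, (∀ k, 0 < (s + lam k).re) → HasMellin φ s (GammaFactor.gammaFactor lam s)) ∧
    (∀ j : GammaFactor.Cls lam,
      AnalyticAt ℂ (GammaFactor.gammaFactor lam) (GammaFactor.m lam j) ∧
      -- the recursion yields the principal part of `γ` at `m_j - 2n`
      (∀ n : ℕ,
        (fun s : ℂ => GammaFactor.gammaFactor lam (s + GammaFactor.m lam j - 2 * (n : ℂ))
          - ∑ k ∈ Finset.Icc 1 (GammaFactor.size lam j), GammaFactor.coeffC lam j n k / s ^ k)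
        =O[𝓝[≠] 0] (fun _ => (1 : ℝ))) ∧
      -- size of the coefficients
      (∀ k ∈ Finset.Icc 1 (GammaFactor.size lam j),
        (fun n : ℕ => GammaFactor.coeffC lam j n k) =O[atTop]
          (fun n : ℕ => (n : ℝ) ^ GammaFactor.growthExponent lam j
            * Real.log n ^ (GammaFactor.size lam j - k) / (n.factorial : ℝ) ^ d))) ∧
    ∀ t : ℝ, 0 < t →
      -- the residue sum
      HasSum (fun z : ℂ =>
        GammaFactor.residue (fun s => GammaFactor.gammaFactor lam s * (t : ℂ) ^ (-s)) z) (φ t) ∧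
      -- the expansion
      (∀ j : GammaFactor.Cls lam,
        Summable fun n : ℕ+ => GammaFactor.logPoly lam j n t * (t : ℂ) ^ (2 * (n : ℕ))) ∧
      φ t = ∑ j : GammaFactor.Cls lam, (t : ℂ) ^ (-GammaFactor.m lam j) *
        ∑' n : ℕ+, GammaFactor.logPoly lam j n t * (t : ℂ) ^ (2 * (n : ℕ)) := by
  subst hφ
  refine ⟨GammaFactor.verticalIntegrable_gammaFactor lam hd (GammaFactor.ne_pole_of_pos lam hσ),
    fun s hs => GammaFactor.hasMellin_mellinInv_gammaFactor lam hd hσ hs,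
    fun j => ⟨GammaFactor.analyticAt_gammaFactor_m lam j,
      GammaFactor.isBigO_gammaFactor_sub_principalPart lam j,
      fun k hk => GammaFactor.isBigO_coeffC lam j hk⟩,
    fun t ht => ⟨?_, fun j => GammaFactor.summable_logPoly lam hd j t, ?_⟩⟩
  -- Residues vanish off the range of `pole`, so the sum over ℂ reduces to the sum over pairs
  -- (class, n).
  · refine ((GammaFactor.pole_injective lam).hasSum_iff
      fun z hz => GammaFactor.residue_mellinIntegrand_of_notMem lam ht hz).1 ?_
    refine (GammaFactor.hasSum_residues lam hd hσ ht).congr_fun ?_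
    exact fun x => (GammaFactor.residue_mellinIntegrand_pole lam ht x)
  · have h := GammaFactor.hasSum_residues lam hd hσ ht
    rw [← h.tsum_eq, h.summable.tsum_prod, tsum_fintype]
    refine Finset.sum_congr rfl fun j _ => ?_
    rw [← tsum_mul_left]
    refine tsum_congr fun n => ?_
    rw [GammaFactor.cpow_neg_pole lam ht]
    ring
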